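/- Let $n \ge 1$, let $B = \operatorname{diag}(b_1,\dots,b_n)$ with $b_1,\dots,b_n \in \mathbb{C}\setminus\{0\}$, let $Q \in L^1([0,1];\mathbb{C}^{n\times n})$, and let $C, D \in \mathbb{C}^{n\times n}$ satisfy $\operatorname{rank}\begin{pmatrix} C & D\end{pmatrix} = n$. Let $\mathfrak{H} = L^2([0,1];\mathbb{C}^n)$, and let $L_{C,D}(Q)$ be the operator in $\mathfrak{H}$ given by $$L_{C,D}(Q)\,y = -iB^{-1}y' + Q(x)y$$ on the domain of all $y \in W^{1,1}([0,1];\mathbb{C}^n)$ (that is, $y$ absolutely continuous on $[0,1]$) such that $-iB^{-1}y' + Qy \in \mathfrak{H}$ and $Cy(0) + Dy(1) = 0$. Its resolvent set $\rho(L_{C,D}(Q))$ is the set of all $\lambda \in \mathbb{C}$ for which $L_{C,D}(Q) - \lambda$ is a bijection of the domain onto $\mathfrak{H}$ with bounded inverse. For a compact operator $T$ on $\mathfrak{H}$ let $s_1(T) \ge s_2(T) \ge \dots$ be its singular values, i.e. the eigenvalues of $(T^*T)^{1/2}$ in decreasing order, counted with multiplicity. Let $\mathcal{S}_1(\mathfrak{H})$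 be the set of compact $T$ with $s_k(T) = O(1/k)$ as $k \to \infty$, and $\mathfrak{S}_1(\mathfrak{H})$ the set of trace class operators, i.e. of compact $T$ with $\sum_k s_k(T) < \infty$. Suppose that $\rho(L_{C,D}(Q)) \neq \varnothing$. Then for every $\lambda \in \rho(L_{C,D}(Q))$ $$(L_{C,D}(Q) - \lambda)^{-1} \in \mathcal{S}_1(\mathfrak{H}) \setminus \mathfrak{S}_1(\mathfrak{H}).$$ Moreover, the sequence of singular values of $(L_{C,D}(Q)-\lambda)^{-1}$ can be decomposed into the union of $n$ disjoint non-increasing subsequences $\{s_{j,k}\}_{k\in\mathbb{N}}$, $j \in \{1,\dots,n\}$, satisfying $$s_{j,k} = \frac{|b_j| + o(1)}{\pi k} \qquad \text{as } k \to \infty.$$ -/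

import Mathlib

open MeasureTheory Filter Topology

namespace DiracBVP

noncomputable section

/-! ### Resolvents of unbounded operators, singular values, operator ideals -/

section Operators

variable {H : Type*} [NormedAddCommGroup H] [InnerProductSpace ℂ H]

/-- The bounded operator `R` is a two-sided inverse of `T - z : dom T → H`. -/
def IsResolventAt (T : H →ₗ.[ℂ] H) (z : ℂ) (R : H →L[ℂ] H) : Prop :=
  (∀ f : H, ∃ hf : R f ∈ T.domain, T ⟨R f, hf⟩ - z • R f = f) ∧
    ∀ u : T.domain, R (T u - z • (u : H)) = u

/-- The resolvent set of an unbounded operator: those `z` for which `T - z` is a bijection from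
`dom T` onto `H` with bounded inverse. -/
def resolventSet (T : H →ₗ.[ℂ] H) : Set ℂ :=
  {z | ∃ R : H →L[ℂ] H, IsResolventAt T z R}

open Classical in
/-- The resolvent `(T - z)⁻¹` (zero by convention off the resolvent set). -/
def resolvent (T : H →ₗ.[ℂ] H) (z : ℂ) : H →L[ℂ] H :=
  if h : ∃ R : H →L[ℂ] H, IsResolventAt T z R then h.choose else 0

theorem isResolventAt_resolvent {T : H →ₗ.[ℂ] H} {z : ℂ} (hz : z ∈ resolventSet T) :
    IsResolventAt T z (resolvent T z) := by
  have h : ∃ R : H →L[ℂ] H, IsResolventAt T z R := hz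
  rw [resolvent, dif_pos h]
  exact h.choose_spec

theorem IsResolventAt.unique {T : H →ₗ.[ℂ] H} {z : ℂ} {R R' : H →L[ℂ] H}
    (h : IsResolventAt T z R) (h' : IsResolventAt T z R') : R = R' := by
  ext f
  obtain ⟨hf, e⟩ := h.1 f
  have := h'.2 ⟨R f, hf⟩
  rw [e] at this
  exact this.symm

variable [CompleteSpace H]

/-- The span of all eigenvectors of `(T* T)^{1/2}` for eigenvalues `≥ t`. As eigenspaces are
independent, its dimension is the number of such eigenvalues, counted with multiplicity. -/
def absEigenspan (T : H →L[ℂ] H) (t : ℝ) : Submodule ℂ H :=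
  ⨆ r : ℝ, ⨆ _ : t ≤ r,
    Module.End.eigenspace ((CFC.abs T : H →L[ℂ] H) : H →ₗ[ℂ] H) (r : ℂ)

/-- The singular values of a compact operator `T`, indexed from `0`: `singularValue T k` is the
`(k+1)`-st largest eigenvalue of `(T* T)^{1/2}` counted with multiplicity, that is, the largest
`t > 0` such that at least `k + 1` eigenvalues are `≥ t` (and `0` if there is no such `t`). -/
def singularValue (T : H →L[ℂ] H) (k : ℕ) : ℝ :=
  sSup {t : ℝ | 0 < t ∧ (k : Cardinal) < Module.rank ℂ (absEigenspan T t)}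

/-- The Schatten-von Neumann ideal of exponent `p`, `0 < p < ∞`. For `p = 1` these are the
trace class operators. -/
def IsSchatten (p : ℝ) (T : H →L[ℂ] H) : Prop :=
  IsCompactOperator T ∧ Summable fun k : ℕ => singularValue T k ^ p

/-- The weak ideal of exponent `p`: compact operators whose `j`-th singular value, `j ≥ 1`, is
`O(j^(-1/p))`. -/
def IsWeakSchatten (p : ℝ) (T : H →L[ℂ] H) : Prop :=
  IsCompactOperator T ∧
    (fun k : ℕ => singularValue T k) =O[atTop] fun k : ℕ => ((k : ℝ) + 1) ^ (-1 / p)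

end Operators

/-! ### The boundary value problem -/

/-- Lebesgue measure on `[0, 1]`. -/
abbrev unitVolume : Measure ℝ := volume.restrict (Set.Icc (0 : ℝ) 1)

/-- The Hilbert space `L²([0, 1]; ℂⁿ)`. -/
abbrev L2 (n : ℕ) : Type := Lp (EuclideanSpace ℂ (Fin n)) 2 unitVolume

/-- `y ∈ W^{1,1}([0, 1]; ℂⁿ)` with derivative `y'`: `y` is absolutely continuous on `[0, 1]`, and
its almost everywhere derivative `y'` is integrable. -/
structure IsW11 {n : ℕ} (y y' : ℝ → EuclideanSpace ℂ (Fin n)) : Prop where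
  absCont : AbsolutelyContinuousOnInterval y 0 1
  integrable : Integrable y' unitVolume
  hasDeriv : ∀ᵐ x ∂unitVolume, HasDerivAt y (y' x) x

/-- The differential expression `-i B⁻¹ y' + Q(x) y` with `B = diag(b₁, …, bₙ)`. -/
def diffExpr {n : ℕ} (b : Fin n → ℂ) (Q : ℝ → Matrix (Fin n) (Fin n) ℂ)
    (y y' : ℝ → EuclideanSpace ℂ (Fin n)) (x : ℝ) : EuclideanSpace ℂ (Fin n) :=
  WithLp.toLp 2
    ((-Complex.I) • (Matrix.diagonal b)⁻¹.mulVec (y' x).ofLp + (Q x).mulVec (y x).ofLp)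

/-- The graph of the operator `L_{C,D}(Q)`: pairs `(f, g)` in `L² × L²` such that `f` is (the class
of) some `y ∈ W^{1,1}` with `C y(0) + D y(1) = 0` and `g = -i B⁻¹ y' + Q y`. -/
def opGraph {n : ℕ} (b : Fin n → ℂ) (C D : Matrix (Fin n) (Fin n) ℂ)
    (Q : ℝ → Matrix (Fin n) (Fin n) ℂ) : Submodule ℂ (L2 n × L2 n) where
  carrier := {p | ∃ y y' : ℝ → EuclideanSpace ℂ (Fin n), IsW11 y y' ∧
    C.mulVec (y 0).ofLp + D.mulVec (y 1).ofLp = 0 ∧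
    p.1 =ᵐ[unitVolume] y ∧ p.2 =ᵐ[unitVolume] diffExpr b Q y y'}
  zero_mem' := by
    refine ⟨0, 0, ⟨?_, integrable_zero _ _ _, ?_⟩, by simp, Lp.coeFn_zero _ _ _, ?_⟩
    · simp [AbsolutelyContinuousOnInterval, tendsto_const_nhds]
    · exact Eventually.of_forall fun x => hasDerivAt_const x 0
    · refine (Lp.coeFn_zero _ _ _).trans (Eventually.of_forall fun x => ?_)
      simp [diffExpr]
  add_mem' := by
    rintro p q ⟨y, y', hy, hb, h1, h2⟩ ⟨z, z', hz, hc, k1, k2⟩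
    refine ⟨y + z, y' + z', ⟨hy.1.add hz.1, hy.2.add hz.2, ?_⟩, ?_, ?_, ?_⟩
    · filter_upwards [hy.3, hz.3] with x a c using a.add c
    · simp only [Pi.add_apply, WithLp.ofLp_add, Matrix.mulVec_add]
      rw [add_add_add_comm, hb, hc, add_zero]
    · exact (Lp.coeFn_add _ _).trans (h1.add k1)
    · refine (Lp.coeFn_add _ _).trans ((h2.add k2).trans (Eventually.of_forall fun x => ?_))
      simp only [diffExpr, Pi.add_apply, WithLp.ofLp_add, Matrix.mulVec_add, smul_add,
        ← WithLp.toLp_add]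
      congr 1
      abel
  smul_mem' := by
    rintro c p ⟨y, y', hy, hb, h1, h2⟩
    refine ⟨fun x => c • y x, fun x => c • y' x,
      ⟨hy.1.const_smul c, hy.2.smul c, ?_⟩, ?_, ?_, ?_⟩
    · filter_upwards [hy.3] with x a using a.const_smul c
    · simp only [WithLp.ofLp_smul, Matrix.mulVec_smul]
      rw [← smul_add, hb, smul_zero]
    · exact (Lp.coeFn_smul _ _).trans (h1.const_smul c)
    · refine (Lp.coeFn_smul _ _).trans ((h2.const_smul c).trans (Eventually.of_forall fun x => ?_))
      simp only [Pi.smul_apply, diffExpr, WithLp.ofLp_smul, Matrix.mulVec_smul,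
        ← WithLp.toLp_smul]
      rw [smul_add, smul_comm c]

/-- The operator `L_{C,D}(Q)` in `L²([0, 1]; ℂⁿ)`; its graph is `opGraph`, see `graph_op`. -/
def op {n : ℕ} (b : Fin n → ℂ) (C D : Matrix (Fin n) (Fin n) ℂ)
    (Q : ℝ → Matrix (Fin n) (Fin n) ℂ) : L2 n →ₗ.[ℂ] L2 n :=
  (opGraph b C D Q).toLinearPMap

theorem opGraph_functional {n : ℕ} (b : Fin n → ℂ) (C D : Matrix (Fin n) (Fin n) ℂ)
    (Q : ℝ → Matrix (Fin n) (Fin n) ℂ) (p : L2 n × L2 n) (hp : p ∈ opGraph b C D Q)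
    (hp0 : p.1 = 0) : p.2 = 0 := by
  obtain ⟨y, y', hy, -, h1, h2⟩ := hp
  rw [hp0] at h1
  have hae : y =ᵐ[unitVolume] (fun _ => 0) := h1.symm.trans (Lp.coeFn_zero _ _ _)
  have hcont : ContinuousOn y (Set.Icc 0 1) := by
    simpa using hy.absCont.continuousOn
  have hEq : Set.EqOn y (fun _ => 0) (Set.Icc 0 1) :=
    Measure.eqOn_Icc_of_ae_eq volume zero_ne_one hae hcont continuousOn_const
  have hIoo : ∀ᵐ x ∂unitVolume, x ∈ Set.Ioo (0 : ℝ) 1 := by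
    rw [unitVolume, ← restrict_Ioo_eq_restrict_Icc]
    exact ae_restrict_mem measurableSet_Ioo
  refine Lp.ext (h2.trans ?_)
  refine EventuallyEq.trans ?_ (Lp.coeFn_zero _ _ _).symm
  filter_upwards [hIoo, hy.hasDeriv] with x hx hd
  have hloc : y =ᶠ[𝓝 x] fun _ => 0 := by
    filter_upwards [Ioo_mem_nhds hx.1 hx.2] with t ht using hEq ⟨ht.1.le, ht.2.le⟩
  have hd0 : y' x = 0 := hd.unique ((hasDerivAt_const x 0).congr_of_eventuallyEq hloc)
  have hy0 : y x = 0 := hEq ⟨hx.1.le, hx.2.le⟩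
  simp [diffExpr, hd0, hy0]

theorem graph_op {n : ℕ} (b : Fin n → ℂ) (C D : Matrix (Fin n) (Fin n) ℂ)
    (Q : ℝ → Matrix (Fin n) (Fin n) ℂ) : (op b C D Q).graph = opGraph b C D Q :=
  Submodule.toLinearPMap_graph_eq _ (opGraph_functional b C D Q)

end

end DiracBVP

namespace DiracBVP

/-! ### Singular values: min-max bounds and compactness -/

section SingularValues

variable {H : Type*} [NormedAddCommGroup H] [InnerProductSpace ℂ H] [CompleteSpace H]

/-! If `y = R f` is the resolvent applied to `f`, then `y(x) = y(0) + iB ∫₀ˣ (f + (z - Q) y)`. The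
claim is that only the leading term `K f = iB ∫₀ˣ f` matters for the asymptotics of singular values.

Remainder (`exists_remainder_bound`): cut `[0, 1]` into `k` cells of equal mass for the weight `1 +
‖z‖ + ∑ |Q_jl|`, and restrict to those `f` for which `y` vanishes at `0` and at the grid points and
`∫₀^g (z - Q) y = 0` for every grid point `g`. This costs `O(k)` dimensions. On a cell,
Cauchy–Schwarz gives `y = O(k^(-1/2)) ‖f‖`, and `R f - K f` reduces to an integral of `(z - Q) y`
over part of one cell, hence is `O(k^(-3/2)) ‖f‖`.

Leading term (`exists_leadingTerm_le`, `exists_le_leadingTerm`): by Parseval, up to finitely many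
dimensions, `K` scales the mode `e^{2πikx}` in coordinate `j` by `|b_j| / (2π|k|)`. With `S = ∑
|b_j|`, about `2SX` modes have a factor at least `1 / (2πX)`.

Since `k^(-3/2) = o(1/k)`, one may take `k = aN` with small `a`: the codimension is then a small
fraction of `N` while the error is `o(1/N)`. Min-max (`singularValue_le`, `le_singularValue`) yields
`N s_N → S/π` (`tendsto_singularValue`), so the singular values are comparable to the harmonic
sequence: weak ideal, not trace class.

The splitting then needs no spectral information: divide `ℕ` into `n` sets of densities `|b_j| / S`
(`exists_partition_of_densities`). The `k`-th element of the `j`-th set is about `kS / |b_j|`, and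
the singular value there about `|b_j| / (πk)`. -/

theorem isSelfAdjoint_abs (T : H →L[ℂ] H) : IsSelfAdjoint (CFC.abs T) :=
  (CFC.abs_nonneg T).isSelfAdjoint

theorem isSymmetric_abs (T : H →L[ℂ] H) :
    ((CFC.abs T : H →L[ℂ] H) : H →ₗ[ℂ] H).IsSymmetric :=
  (isSelfAdjoint_abs T).isSymmetric

theorem norm_abs_apply (T : H →L[ℂ] H) (f : H) : ‖CFC.abs T f‖ = ‖T f‖ := by
  have h : (inner ℂ (CFC.abs T f) (CFC.abs T f) : ℂ) = inner ℂ (T f) (T f) := by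
    have h1 := isSymmetric_abs T f (CFC.abs T f)
    simp only [ContinuousLinearMap.coe_coe] at h1
    rw [h1, ← mul_apply_eq_comp, CFC.abs_mul_abs, mul_apply_eq_comp,
      ContinuousLinearMap.star_eq_adjoint, ContinuousLinearMap.adjoint_inner_right]
  rw [inner_self_eq_norm_sq_to_K, inner_self_eq_norm_sq_to_K] at h
  have h2 : ‖CFC.abs T f‖ ^ 2 = ‖T f‖ ^ 2 := by exact_mod_cast h
  exact (pow_left_inj₀ (norm_nonneg _) (norm_nonneg _) two_ne_zero).1 h2

/-- Eigenspaces of the self-adjoint `|T|` are orthogonal, so Pythagoras applies to the finite sum of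
eigenvectors representing `f`. Compactness plays no role here. -/
theorem le_norm_of_mem_absEigenspan (T : H →L[ℂ] H) {s : ℝ} (hs : 0 ≤ s) {f : H}
    (hf : f ∈ absEigenspan T s) : s * ‖f‖ ≤ ‖T f‖ := by
  classical
  have hinj : Function.Injective fun r : {r : ℝ // s ≤ r} => ((r : ℝ) : ℂ) :=
    fun a b h => Subtype.ext (Complex.ofReal_injective h)
  have hO := ((isSymmetric_abs T).orthogonalFamily_eigenspaces).comp hinj
  rw [absEigenspan, iSup_subtype', Submodule.mem_iSup_iff_exists_dfinsupp'] at hf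
  obtain ⟨v, hv⟩ := hf
  have hfe : f = ∑ r ∈ v.support, (v r : H) := by rw [← hv, DFinsupp.sum]
  have h1 : ‖f‖ ^ 2 = ∑ r ∈ v.support, ‖v r‖ ^ 2 := by
    rw [hfe]
    exact hO.norm_sum (fun r => v r) v.support
  have h2 : ‖CFC.abs T f‖ ^ 2 = ∑ r ∈ v.support, (r : ℝ) ^ 2 * ‖v r‖ ^ 2 := by
    have h3 : CFC.abs T f = ∑ r ∈ v.support, (((r : ℝ) : ℂ) • (v r) : H) := by
      rw [hfe, map_sum]
      exact Finset.sum_congr rfl fun r _ => Module.End.mem_eigenspace_iff.1 (v r).2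
    have h4 := hO.norm_sum (fun r => (((r : ℝ) : ℂ)) • v r) v.support
    rw [h3]
    refine h4.trans (Finset.sum_congr rfl fun r _ => ?_)
    rw [norm_smul, mul_pow, Complex.norm_real, Real.norm_eq_abs, sq_abs]
  rw [← norm_abs_apply]
  refine le_of_sq_le_sq ?_ (norm_nonneg _)
  rw [mul_pow, h1, h2, Finset.mul_sum]
  refine Finset.sum_le_sum fun r _ => ?_
  have := r.2
  gcongr

theorem eigenspace_le_absEigenspan (T : H →L[ℂ] H) {t r : ℝ} (h : t ≤ r) :
    Module.End.eigenspace ((CFC.abs T : H →L[ℂ] H) : H →ₗ[ℂ] H) (r : ℂ) ≤ absEigenspan T t :=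
  le_iSup₂_of_le r h le_rfl

/-- The real `sSup` of an unbounded set is `0`, so every use of the supremum needs this bound; it
holds because eigenvalues of `|T|` do not exceed `‖T‖`. -/
theorem bddAbove_singularValue (T : H →L[ℂ] H) (k : ℕ) :
    BddAbove {t : ℝ | 0 < t ∧ (k : Cardinal) < Module.rank ℂ (absEigenspan T t)} := by
  refine ⟨‖T‖, fun t ⟨ht, hk⟩ => ?_⟩
  have : absEigenspan T t ≠ ⊥ := by
    intro h
    rw [h] at hk
    simp at hk
  obtain ⟨f, hf, hf0⟩ := Submodule.exists_mem_ne_zero_of_ne_bot this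
  have h1 := (le_norm_of_mem_absEigenspan T ht.le hf).trans (T.le_opNorm f)
  exact le_of_mul_le_mul_right h1 (norm_pos_iff.2 hf0)

theorem singularValue_nonneg (T : H →L[ℂ] H) (k : ℕ) : 0 ≤ singularValue T k :=
  Real.sSup_nonneg fun _ ht => ht.1.le

theorem singularValue_antitone (T : H →L[ℂ] H) : Antitone (singularValue T) := by
  intro k l hkl
  rcases Set.eq_empty_or_nonempty
    {t : ℝ | 0 < t ∧ (l : Cardinal) < Module.rank ℂ (absEigenspan T t)} with h | h
  · rw [singularValue, h, Real.sSup_empty]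
    exact singularValue_nonneg T k
  · refine csSup_le_csSup (bddAbove_singularValue T k) h fun t ht => ⟨ht.1, lt_of_le_of_lt ?_ ht.2⟩
    exact_mod_cast hkl

/-- Upper bound for singular values by a bound on a subspace of finite codimension. -/
theorem singularValue_le {ι : Type*} [Fintype ι] (T : H →L[ℂ] H) {t : ℝ} (ht : 0 ≤ t)
    (Λ : H →ₗ[ℂ] (ι → ℂ)) (hΛ : ∀ f, Λ f = 0 → ‖T f‖ ≤ t * ‖f‖) {k : ℕ}
    (hk : Fintype.card ι ≤ k) : singularValue T k ≤ t := by
  refine Real.sSup_le (fun s ⟨hs, hks⟩ => ?_) ht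
  by_contra! hst
  -- For `s > t` the lower bound on the eigenspan contradicts the upper bound on `ker Λ`. So the
  -- eigenspan embeds into `ℂ^ι` and its rank is at most `k`.
  have hinj : Function.Injective (Λ.domRestrict (absEigenspan T s)) := by
    rw [← LinearMap.ker_eq_bot, LinearMap.ker_eq_bot']
    rintro ⟨f, hf⟩ h0
    have h1 := (le_norm_of_mem_absEigenspan T hs.le hf).trans (hΛ f h0)
    by_contra hne
    have hpos : 0 < ‖f‖ := norm_pos_iff.2 fun h => hne (Subtype.ext h)
    exact absurd (le_of_mul_le_mul_right h1 hpos) (not_le.2 hst)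
  have h2 := LinearMap.lift_rank_le_of_injective _ hinj
  rw [rank_fun'] at h2
  have h3 : Module.rank ℂ (absEigenspan T s) ≤ k := by
    rw [← Cardinal.lift_le, Cardinal.lift_natCast]
    refine h2.trans ?_
    rw [Cardinal.lift_natCast]
    exact_mod_cast hk
  exact absurd hks (not_lt.2 h3)

/-- The complement reduces `|T|`. The restriction is compact, self-adjoint and nonnegative, so its
norm is an eigenvalue; were it `≥ t`, the eigenvector would lie in the eigenspan and in its
complement. The strict inequality is what the min-max argument below needs. -/
theorem norm_lt_of_mem_orthogonal_absEigenspan {T : H →L[ℂ] H}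
    (hT : IsCompactOperator (CFC.abs T : H →L[ℂ] H)) {t : ℝ} (ht : 0 < t) {f : H}
    (hf : f ∈ (absEigenspan T t)ᗮ) (hf0 : f ≠ 0) : ‖T f‖ < t * ‖f‖ := by
  by_contra! hle
  rw [← norm_abs_apply] at hle
  set S : H →L[ℂ] H := CFC.abs T with hS
  have hsymm : (S : H →ₗ[ℂ] H).IsSymmetric := isSymmetric_abs T
  have hmaps : ∀ g ∈ absEigenspan T t, S g ∈ absEigenspan T t := by
    intro g hg
    have : absEigenspan T t ≤ (absEigenspan T t).comap (S : H →ₗ[ℂ] H) := by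
      refine iSup_le fun r => iSup_le fun hr => fun v hv => ?_
      have hv' : S v = (r : ℂ) • v := Module.End.mem_eigenspace_iff.1 hv
      rw [Submodule.mem_comap, ContinuousLinearMap.coe_coe, hv']
      refine Submodule.smul_mem _ _ ?_
      exact eigenspace_le_absEigenspan T hr hv
    exact this hg
  have hinv : ∀ g ∈ (absEigenspan T t)ᗮ, S g ∈ (absEigenspan T t)ᗮ := by
    intro g hg
    rw [Submodule.mem_orthogonal] at hg ⊢
    intro u hu
    have := hsymm u g
    simp only [ContinuousLinearMap.coe_coe] at this
    rw [← this]
    exact hg _ (hmaps u hu)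
  let W := (absEigenspan T t)ᗮ
  let SW : W →L[ℂ] W := S.restrict hinv
  have hcomp : IsCompactOperator SW := hT.restrict' (f := (S : H →ₗ[ℂ] H)) hinv
  have hSW : (SW : W →ₗ[ℂ] W).IsSymmetric := hsymm.restrict_invariant hinv
  have hnorm : t ≤ ‖SW‖ := by
    have h1 : ‖SW ⟨f, hf⟩‖ ≤ ‖SW‖ * ‖(⟨f, hf⟩ : W)‖ := SW.le_opNorm _
    exact le_of_mul_le_mul_right (hle.trans h1) (norm_pos_iff.2 hf0)
  have : Nontrivial W := ⟨⟨⟨f, hf⟩, 0, fun h => hf0 (congrArg Subtype.val h)⟩⟩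
  obtain ⟨μ, hμ, hμn⟩ := spectrum.exists_nnnorm_eq_spectralRadius SW
  rw [SW.spectralRadius_eq_nnnorm hSW.isSelfAdjoint, ENNReal.coe_inj] at hμn
  have hμn' : ‖μ‖ = ‖SW‖ := congrArg NNReal.toReal hμn
  have hμ0 : μ ≠ 0 := norm_pos_iff.1 (by rw [hμn']; exact ht.trans_le hnorm)
  have hev := (hcomp.hasEigenvalue_iff_mem_spectrum hμ0).2 hμ
  have hreal : (μ.re : ℂ) = μ := Complex.conj_eq_iff_re.1 (hSW.conj_eigenvalue_eq_self hev)
  have hpos : 0 ≤ μ.re := by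
    rw [← hreal] at hev
    refine eigenvalue_nonneg_of_nonneg hev fun x => ?_
    have h0 : (0 : H →L[ℂ] H) ≤ S := CFC.abs_nonneg T
    exact ((ContinuousLinearMap.nonneg_iff_isPositive S).1 h0).re_inner_nonneg_right (x : H)
  have hge : t ≤ μ.re := by
    rw [← hreal, Complex.norm_real, Real.norm_eq_abs, abs_of_nonneg hpos] at hμn'
    rw [hμn']
    exact hnorm
  obtain ⟨v, hv⟩ := hev.exists_hasEigenvector
  have hv1 : S (v : H) = μ • (v : H) := congrArg Subtype.val hv.apply_eq_smul
  have hv2 : (v : H) ∈ absEigenspan T t := by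
    refine eigenspace_le_absEigenspan T hge ?_
    rw [Module.End.mem_eigenspace_iff, hreal]
    exact hv1
  exact hv.2 (Subtype.ext (inner_self_eq_zero.1 (v.2 (v : H) hv2)))

/-- The operator is arbitrarily small on suitable subspaces of finite codimension. -/
def IsSmallOnKernels (T : H →L[ℂ] H) : Prop :=
  ∀ ε > 0, ∃ (ι : Type) (_ : Fintype ι) (Λ : H →ₗ[ℂ] (ι → ℂ)), ∀ f, Λ f = 0 → ‖T f‖ ≤ ε * ‖f‖

/-- An operator that is arbitrarily small on subspaces of finite codimension is compact. -/
theorem IsSmallOnKernels.isCompactOperator {T : H →L[ℂ] H} (hT : IsSmallOnKernels T) :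
    IsCompactOperator T := by
  have hmem : T ∈ closure {S : H →L[ℂ] H | IsCompactOperator S} := by
    rw [Metric.mem_closure_iff]
    intro ε hε
    obtain ⟨ι, _, Λ, hΛ⟩ := hT (ε / 2) (half_pos hε)
    let K : Submodule ℂ H := (LinearMap.ker Λ)ᗮ
    have hinj : Function.Injective (Λ.domRestrict K) := by
      rw [← LinearMap.ker_eq_bot, LinearMap.ker_eq_bot']
      rintro ⟨f, hf⟩ h0
      exact Subtype.ext (inner_self_eq_zero.1 (hf f h0))
    have hfin : FiniteDimensional ℂ K := FiniteDimensional.of_injective _ hinj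
    refine ⟨T ∘L K.starProjection, ?_, ?_⟩
    · have h1 : IsCompactOperator (T ∘L K.subtypeL) :=
        ((isCompactOperator_id_iff_finiteDimensional (𝕜 := ℂ)).2 hfin).clm_comp (T ∘L K.subtypeL)
      exact h1.comp_clm K.orthogonalProjectionOnto
    · rw [dist_eq_norm]
      refine lt_of_le_of_lt (ContinuousLinearMap.opNorm_le_bound _ (half_pos hε).le fun f => ?_)
        (half_lt_self hε)
      -- `Λ` need not be continuous, so its kernel need not be closed; the bound extends to the
      -- closure, which is `Kᗮ`.
      have hcl : ∀ g ∈ closure (LinearMap.ker Λ : Set H), ‖T g‖ ≤ ε / 2 * ‖g‖ := by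
        have hclosed : IsClosed {g : H | ‖T g‖ ≤ ε / 2 * ‖g‖} :=
          isClosed_le (by fun_prop) (by fun_prop)
        exact fun g hg => closure_minimal (fun g hg => hΛ g hg) hclosed hg
      have hg : f - K.starProjection f ∈ closure (LinearMap.ker Λ : Set H) := by
        rw [← Submodule.topologicalClosure_coe, ← Submodule.orthogonal_orthogonal_eq_closure]
        exact K.sub_starProjection_mem_orthogonal f
      have h2 : ‖f - K.starProjection f‖ ≤ ‖f‖ := by
        rw [← Submodule.starProjection_orthogonal_val]
        exact Kᗮ.norm_starProjection_apply_le f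
      calc ‖(T - T ∘L K.starProjection) f‖ = ‖T (f - K.starProjection f)‖ := by simp
        _ ≤ ε / 2 * ‖f - K.starProjection f‖ := hcl _ hg
        _ ≤ ε / 2 * ‖f‖ := by gcongr
  rwa [IsClosed.closure_eq isClosed_setOfPred_isCompactOperator] at hmem

/-- Lower bound for singular values by a bound on a subspace of finite dimension. -/
theorem le_singularValue {T : H →L[ℂ] H} (hT : IsSmallOnKernels T)
    {t : ℝ} (ht : 0 < t) (V : Submodule ℂ H) [FiniteDimensional ℂ V] {k : ℕ}
    (hk : k < Module.finrank ℂ V) (hV : ∀ f ∈ V, t * ‖f‖ ≤ ‖T f‖) : t ≤ singularValue T k := by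
  have habs : IsSmallOnKernels (CFC.abs T) := by
    simpa only [IsSmallOnKernels, norm_abs_apply] using hT
  refine le_csSup (bddAbove_singularValue T k) ⟨ht, ?_⟩
  by_contra! hr
  have hfin : FiniteDimensional ℂ (absEigenspan T t) :=
    Module.rank_lt_aleph0_iff.1 (hr.trans_lt (Cardinal.natCast_lt_aleph0))
  have hr' : Module.finrank ℂ (absEigenspan T t) ≤ k := Module.finrank_le_of_rank_le hr
  -- `dim V` exceeds the dimension of the eigenspan, so some nonzero vector of `V` is orthogonal to
  -- it.
  obtain ⟨⟨f, hfV⟩, hf, hf0⟩ := Submodule.exists_mem_ne_zero_of_ne_bot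
    (LinearMap.ker_ne_bot_of_finrank_lt (f := ((absEigenspan T t).orthogonalProjectionOnto :
      H →ₗ[ℂ] absEigenspan T t).domRestrict V) (hr'.trans_lt hk))
  have hf1 : f ∈ (absEigenspan T t)ᗮ := by
    rw [← Submodule.orthogonalProjectionOnto_eq_zero_iff]
    exact hf
  exact absurd (hV f hfV)
    (not_le.2 (norm_lt_of_mem_orthogonal_absEigenspan habs.isCompactOperator ht hf1 fun h => hf0 (Subtype.ext h)))

end SingularValues

/-! ### Splitting `ℕ` into subsequences of given densities -/

section Densities

/-- An index maximizing the deficit `(N + 1) p j - a j`. -/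
noncomputable def greedyChoice {n : ℕ} [NeZero n] (p : Fin n → ℝ) (N : ℕ) (a : Fin n → ℕ) :
    Fin n :=
  (Finite.exists_max fun j => ((N : ℝ) + 1) * p j - a j).choose

/-- The number of times each index is used by the first `N` steps of the greedy algorithm. -/
noncomputable def greedyCount {n : ℕ} [NeZero n] (p : Fin n → ℝ) : ℕ → Fin n → ℕ
  | 0 => 0
  | N + 1 => greedyCount p N + Pi.single (greedyChoice p N (greedyCount p N)) 1

/-- The greedy colouring of `ℕ` with densities `p`. -/
noncomputable def greedyColour {n : ℕ} [NeZero n] (p : Fin n → ℝ) (N : ℕ) : Fin n :=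
  greedyChoice p N (greedyCount p N)

variable {n : ℕ} [NeZero n] (p : Fin n → ℝ)

theorem le_greedyChoice (N : ℕ) (a : Fin n → ℕ) (j : Fin n) :
    ((N : ℝ) + 1) * p j - a j ≤
      ((N : ℝ) + 1) * p (greedyChoice p N a) - a (greedyChoice p N a) :=
  (Finite.exists_max fun j => ((N : ℝ) + 1) * p j - a j).choose_spec j

theorem sum_greedyCount (N : ℕ) : ∑ j, greedyCount p N j = N := by
  induction N with
  | zero => simp [greedyCount]
  | succ N ih => simp [greedyCount, Finset.sum_add_distrib, ih]

theorem count_greedyColour (j : Fin n) (N : ℕ) :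
    Nat.count (fun m => greedyColour p m = j) N = greedyCount p N j := by
  induction N with
  | zero => simp [greedyCount]
  | succ N ih =>
    rw [Nat.count_succ, ih, greedyCount, Pi.add_apply, Pi.single_apply]
    simp only [greedyColour, eq_comm]

variable {p}

/-- Before each step the deficits sum to `(N + 1) - N = 1`, so the largest one, that of the chosen
index, is positive. -/
theorem greedyCount_lt (hp : ∀ j, 0 < p j) (hsum : ∑ j, p j = 1) (N : ℕ) (j : Fin n) :
    (greedyCount p N j : ℝ) < N * p j + 1 := by
  induction N generalizing j with
  | zero => simp [greedyCount]
  | succ N ih =>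
    have hpos := hp j
    rw [greedyCount, Pi.add_apply, Pi.single_apply]
    push_cast
    split_ifs with h
    · have h1 : 0 < ∑ i, (((N : ℝ) + 1) * p i - greedyCount p N i) := by
        rw [Finset.sum_sub_distrib, ← Finset.mul_sum, hsum]
        have := sum_greedyCount p N
        have h2 : (∑ i, (greedyCount p N i : ℝ)) = N := by exact_mod_cast this
        rw [h2]
        linarith
      obtain ⟨i, -, hi⟩ := Finset.exists_lt_of_sum_lt (s := Finset.univ)
        (f := fun _ : Fin n => (0 : ℝ)) (g := fun i => ((N : ℝ) + 1) * p i - greedyCount p N i) (by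
          rwa [Finset.sum_const_zero])
      have h3 := le_greedyChoice p N (greedyCount p N) i
      rw [← h] at h3
      linarith
    · have := ih j
      linarith

/-- The counts sum to `N`, so the upper bounds for the other indices bound this one from below. -/
theorem lt_greedyCount (hp : ∀ j, 0 < p j) (hsum : ∑ j, p j = 1) (N : ℕ) (j : Fin n) :
    N * p j - n ≤ (greedyCount p N j : ℝ) := by
  have h1 : (∑ i, (greedyCount p N i : ℝ)) = N := by exact_mod_cast sum_greedyCount p N
  have h2 : ∑ i ∈ Finset.univ.erase j, (greedyCount p N i : ℝ) ≤
      ∑ i ∈ Finset.univ.erase j, (N * p i + 1) :=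
    Finset.sum_le_sum fun i _ => (greedyCount_lt hp hsum N i).le
  rw [Finset.sum_add_distrib, ← Finset.mul_sum] at h2
  have h3 := Finset.add_sum_erase Finset.univ (fun i => (greedyCount p N i : ℝ))
    (Finset.mem_univ j)
  have h4 := Finset.add_sum_erase Finset.univ p (Finset.mem_univ j)
  have h5 : (∑ i ∈ Finset.univ.erase j, (1 : ℝ)) ≤ n := by
    simp
  have h6 : ∑ i ∈ Finset.univ.erase j, p i = 1 - p j := by linarith
  rw [h6] at h2
  linarith

/-- The natural numbers split into `n` subsequences of prescribed densities. -/
theorem exists_partition_of_densities (hp : ∀ j, 0 < p j) (hsum : ∑ j, p j = 1) :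
    ∃ ν : Fin n → ℕ → ℕ, (∀ j, StrictMono (ν j)) ∧
      Function.Bijective (fun q : Fin n × ℕ => ν q.1 q.2) ∧
      ∀ j, Tendsto (fun k : ℕ => ((k : ℝ) + 1) / (ν j k + 1)) atTop (𝓝 (p j)) := by
  have hinf : ∀ j, {m | greedyColour p m = j}.Infinite := by
    intro j hfin
    obtain ⟨N, hN⟩ := exists_nat_gt (((hfin.toFinset.card : ℝ) + n) / p j)
    rw [div_lt_iff₀ (hp j)] at hN
    have h1 := lt_greedyCount hp hsum N j
    rw [← count_greedyColour, Nat.count_eq_card_filter_range] at h1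
    have h2 : ((Finset.range N).filter fun m => greedyColour p m = j).card ≤
        hfin.toFinset.card := Finset.card_le_card fun m hm =>
      hfin.mem_toFinset.2 (Finset.mem_filter.1 hm).2
    have h3 : (((Finset.range N).filter fun m => greedyColour p m = j).card : ℝ) ≤
        hfin.toFinset.card := by exact_mod_cast h2
    linarith
  refine ⟨fun j => Nat.nth fun m => greedyColour p m = j, fun j => Nat.nth_strictMono (hinf j),
    ⟨?_, ?_⟩, fun j => ?_⟩
  · rintro ⟨j, k⟩ ⟨j', k'⟩ h
    simp only at h
    have h1 : greedyColour p (Nat.nth (fun m => greedyColour p m = j) k) = j :=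
      Nat.nth_mem_of_infinite (hinf j) k
    have h2 : greedyColour p (Nat.nth (fun m => greedyColour p m = j') k') = j' :=
      Nat.nth_mem_of_infinite (hinf j') k'
    rw [h, h2] at h1
    subst h1
    exact Prod.ext rfl (Nat.nth_injective (hinf _) h)
  · intro m
    exact ⟨(greedyColour p m, Nat.count (fun l => greedyColour p l = greedyColour p m) m),
      Nat.nth_count rfl⟩
  · set ν := Nat.nth fun m => greedyColour p m = j with hν
    have hmono : StrictMono ν := Nat.nth_strictMono (hinf j)
    have hcount : ∀ k, greedyCount p (ν k) j = k := fun k => by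
      rw [← count_greedyColour]
      exact Nat.count_nth_of_infinite (hinf j) k
    -- The two discrepancy bounds at time `ν k`, when colour `j` has been used exactly `k` times,
    -- give `|k + 1 - p j (ν k + 1)| ≤ n + 2`.
    have h0 : Tendsto (fun k : ℕ => ((n : ℝ) + 2) / (ν k + 1)) atTop (𝓝 0) := by
      refine Tendsto.div_atTop tendsto_const_nhds ?_
      exact tendsto_atTop_add_const_right _ _
        (tendsto_natCast_atTop_atTop.comp hmono.tendsto_atTop)
    rw [tendsto_iff_norm_sub_tendsto_zero]
    refine squeeze_zero (fun _ => norm_nonneg _) (fun k => ?_) h0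
    have hpos : (0 : ℝ) < ν k + 1 := by positivity
    rw [div_sub' hpos.ne', norm_div, Real.norm_of_nonneg hpos.le, Real.norm_eq_abs]
    gcongr
    have h1 := greedyCount_lt hp hsum (ν k) j
    have h2 := lt_greedyCount hp hsum (ν k) j
    rw [hcount] at h1 h2
    have h3 : p j ≤ 1 := hsum ▸ Finset.single_le_sum (fun i _ => (hp i).le) (Finset.mem_univ j)
    have h4 := hp j
    have h5 : (0 : ℝ) ≤ n := by positivity
    rw [abs_le]
    constructor <;> linarith

end Densities

/-! ### From two-sided bounds to a limit -/

section Asymptotics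

theorem tendsto_mul_remainder {r : ℕ → ℝ} (hr : Tendsto (fun k : ℕ => (k : ℝ) * r k) atTop (𝓝 0))
    {a : ℝ} (ha : 0 < a) :
    Tendsto (fun N : ℕ => ((N : ℝ) + 1) * r ⌊a * N⌋₊) atTop (𝓝 0) := by
  have hk : Tendsto (fun N : ℕ => ⌊a * (N : ℝ)⌋₊) atTop atTop :=
    tendsto_nat_floor_atTop.comp (tendsto_natCast_atTop_atTop.const_mul_atTop ha)
  have h1 : Tendsto (fun N : ℕ => (⌊a * (N : ℝ)⌋₊ : ℝ) / N) atTop (𝓝 a) :=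
    (tendsto_nat_floor_mul_div_atTop ha.le).comp tendsto_natCast_atTop_atTop
  have h2 : Tendsto (fun N : ℕ => ((N : ℝ) + 1) / N) atTop (𝓝 1) := by
    simpa using! (tendsto_natCast_div_add_atTop (1 : ℝ)).inv₀ one_ne_zero
  have h3 := ((h2.mul (h1.inv₀ ha.ne')).mul (hr.comp hk))
  rw [mul_zero] at h3
  refine h3.congr' ?_
  filter_upwards [eventually_gt_atTop 0, hk.eventually_gt_atTop 0] with N hN hkN
  have hN' : (N : ℝ) ≠ 0 := by positivity
  have hk' : (⌊a * (N : ℝ)⌋₊ : ℝ) ≠ 0 := by positivity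
  simp only [Function.comp_apply]
  generalize ⌊a * (N : ℝ)⌋₊ = K at hk' ⊢
  field_simp

/-- Asymptotics of a sequence from two-sided bounds with a free parameter `X` and a remainder
decaying faster than `1 / k`. -/
theorem tendsto_mul_of_bounds {s r : ℕ → ℝ} {S c : ℝ} (hS : 0 < S) (hc : 0 < c) (k₀ : ℕ)
    (hr : Tendsto (fun k : ℕ => (k : ℝ) * r k) atTop (𝓝 0))
    (hup : ∀ (X : ℝ) (k N : ℕ), 0 < X → k₀ ≤ k → 2 * S * X + c * (k + 1) ≤ N →
      s N ≤ 1 / (2 * Real.pi * X) + r k)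
    (hlo : ∀ (X : ℝ) (k N : ℕ), 0 < X → k₀ ≤ k → N + c * (k + 1) ≤ 2 * S * X →
      1 / (2 * Real.pi * X) - r k ≤ s N) :
    Tendsto (fun N : ℕ => ((N : ℝ) + 1) * s N) atTop (𝓝 (S / Real.pi)) := by
  have hpi := Real.pi_pos
  have hratio : Tendsto (fun N : ℕ => ((N : ℝ) + 1) / N) atTop (𝓝 1) := by
    simpa using! (tendsto_natCast_div_add_atTop (1 : ℝ)).inv₀ one_ne_zero
  -- The choice `k = ⌊δN / (2c)⌋` spends at most `δN` of the index on the codimension term: half on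
  -- `ck`, half on the extra `c`.
  have hk : ∀ δ : ℝ, 0 < δ → ∀ᶠ N : ℕ in atTop, 0 < N ∧ k₀ ≤ ⌊δ / (2 * c) * (N : ℝ)⌋₊ ∧
      c * ((⌊δ / (2 * c) * (N : ℝ)⌋₊ : ℝ) + 1) ≤ δ * N := by
    intro δ hδ
    have hk' : Tendsto (fun N : ℕ => ⌊δ / (2 * c) * (N : ℝ)⌋₊) atTop atTop :=
      tendsto_nat_floor_atTop.comp
        (tendsto_natCast_atTop_atTop.const_mul_atTop (by positivity))
    have hbig := (tendsto_natCast_atTop_atTop (R := ℝ)).const_mul_atTop hδ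
    filter_upwards [eventually_gt_atTop 0, hk'.eventually_ge_atTop k₀,
      hbig.eventually_ge_atTop (2 * c)] with N hN hkN hb
    refine ⟨hN, hkN, ?_⟩
    have h1 : (⌊δ / (2 * c) * (N : ℝ)⌋₊ : ℝ) ≤ δ / (2 * c) * N := Nat.floor_le (by positivity)
    have h2 : c * (δ / (2 * c) * N) = δ * N / 2 := by field_simp
    nlinarith
  -- Main term for `X = uN / (2S)`; below, `u = 1 + δ` serves the lower bound and `u = 1 - δ` the
  -- upper one.
  have hlim : ∀ u : ℝ, 0 < u → Tendsto (fun N : ℕ =>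
      ((N : ℝ) + 1) * (1 / (2 * Real.pi * (u * N / (2 * S))))) atTop (𝓝 (S / (Real.pi * u))) := by
    intro u hu
    have h := hratio.mul_const (S / (Real.pi * u))
    rw [one_mul] at h
    refine h.congr' ?_
    filter_upwards [eventually_gt_atTop 0] with N hN
    have hN' : (N : ℝ) ≠ 0 := by positivity
    field_simp
  have hcont : Tendsto (fun u : ℝ => S / (Real.pi * u)) (𝓝 1) (𝓝 (S / Real.pi)) := by
    have : ContinuousAt (fun u : ℝ => S / (Real.pi * u)) 1 := by
      refine ContinuousAt.div continuousAt_const (by fun_prop) (by positivity)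
    simpa using this.tendsto
  rw [tendsto_order]
  constructor
  · intro a ha
    obtain ⟨δ, hδ, hδa⟩ : ∃ δ : ℝ, 0 < δ ∧ a < S / (Real.pi * (1 + δ)) := by
      have h1 : Tendsto (fun δ : ℝ => 1 + δ) (𝓝[>] 0) (𝓝 1) := by
        have : Tendsto (fun δ : ℝ => 1 + δ) (𝓝 0) (𝓝 (1 + 0)) :=
          (continuous_const.add continuous_id).tendsto 0
        rw [add_zero] at this
        exact this.mono_left nhdsWithin_le_nhds
      obtain ⟨δ, h2, h3⟩ := (((hcont.comp h1).eventually (lt_mem_nhds ha)).and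
        self_mem_nhdsWithin).exists
      exact ⟨δ, h3, h2⟩
    have hl := (hlim (1 + δ) (by linarith)).sub
      (tendsto_mul_remainder hr (a := δ / (2 * c)) (by positivity))
    rw [sub_zero] at hl
    filter_upwards [hl.eventually (lt_mem_nhds hδa), hk δ hδ] with N h1 ⟨hN, hk0, hkc⟩
    refine h1.trans_le ?_
    rw [← mul_sub]
    have hN' : (0 : ℝ) < N := by exact_mod_cast hN
    refine mul_le_mul_of_nonneg_left (hlo _ _ _ (by positivity) hk0 ?_) (by positivity)
    have : 2 * S * ((1 + δ) * N / (2 * S)) = (1 + δ) * N := by field_simp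
    rw [this]
    linarith
  · intro a ha
    obtain ⟨δ, hδ, hδ1, hδa⟩ : ∃ δ : ℝ, 0 < δ ∧ δ < 1 ∧ S / (Real.pi * (1 - δ)) < a := by
      have h1 : Tendsto (fun δ : ℝ => 1 - δ) (𝓝[>] 0) (𝓝 1) := by
        have : Tendsto (fun δ : ℝ => 1 - δ) (𝓝 0) (𝓝 (1 - 0)) :=
          (continuous_const.sub continuous_id).tendsto 0
        rw [sub_zero] at this
        exact this.mono_left nhdsWithin_le_nhds
      obtain ⟨δ, ⟨h2, h3⟩, h4⟩ := ((((hcont.comp h1).eventually (gt_mem_nhds ha)).and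
        self_mem_nhdsWithin).and
          (nhdsWithin_le_nhds (gt_mem_nhds (zero_lt_one (α := ℝ))))).exists
      exact ⟨δ, h3, h4, h2⟩
    have hl := (hlim (1 - δ) (by linarith)).add
      (tendsto_mul_remainder hr (a := δ / (2 * c)) (by positivity))
    rw [add_zero] at hl
    filter_upwards [hl.eventually (gt_mem_nhds hδa), hk δ hδ] with N h1 ⟨hN, hk0, hkc⟩
    refine lt_of_le_of_lt ?_ h1
    rw [← mul_add]
    have hN' : (0 : ℝ) < N := by exact_mod_cast hN
    have hδ2 : 0 < 1 - δ := by linarith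
    refine mul_le_mul_of_nonneg_left (hup _ _ _ (by positivity) hk0 ?_) (by positivity)
    have : 2 * S * ((1 - δ) * N / (2 * S)) = (1 - δ) * N := by field_simp
    rw [this]
    linarith

end Asymptotics

/-! ### Vector-valued absolutely continuous functions -/

section AbsolutelyContinuous

theorem absolutelyContinuousOnInterval_of_dist_le {X Y : Type*} [PseudoMetricSpace X]
    [PseudoMetricSpace Y] {F : ℝ → X} {g : ℝ → Y} {a b : ℝ}
    (hg : AbsolutelyContinuousOnInterval g a b)
    (h : ∀ x ∈ Set.uIcc a b, ∀ y ∈ Set.uIcc a b, dist (F x) (F y) ≤ dist (g x) (g y)) :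
    AbsolutelyContinuousOnInterval F a b := by
  rw [absolutelyContinuousOnInterval_iff] at hg ⊢
  intro ε hε
  obtain ⟨δ, hδ, H⟩ := hg ε hε
  refine ⟨δ, hδ, fun P hP hlt => lt_of_le_of_lt (Finset.sum_le_sum fun i hi => ?_) (H P hP hlt)⟩
  exact h _ (hP.1 i hi).1 _ (hP.1 i hi).2

variable {F : Type*} [NormedAddCommGroup F] [NormedSpace ℝ F]

/-- Increments of the primitive are dominated by those of the scalar primitive of `‖f‖`. -/
theorem absolutelyContinuousOnInterval_integral {f : ℝ → F} {a b : ℝ}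
    (hf : IntervalIntegrable f volume a b) :
    AbsolutelyContinuousOnInterval (fun x => ∫ t in a..x, f t) a b := by
  refine absolutelyContinuousOnInterval_of_dist_le
    (hf.norm.absolutelyContinuousOnInterval_intervalIntegral Set.left_mem_uIcc)
    fun x hx y hy => ?_
  have hax : IntervalIntegrable f volume a x :=
    hf.mono_set (Set.uIcc_subset_uIcc Set.left_mem_uIcc hx)
  have hay : IntervalIntegrable f volume a y :=
    hf.mono_set (Set.uIcc_subset_uIcc Set.left_mem_uIcc hy)
  rw [dist_eq_norm, dist_eq_norm, intervalIntegral.integral_interval_sub_left hax hay,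
    intervalIntegral.integral_interval_sub_left hax.norm hay.norm]
  exact intervalIntegral.norm_integral_le_abs_integral_norm

/-- The fundamental theorem of calculus for absolutely continuous vector-valued functions. -/
theorem eq_add_integral_of_ae_hasDerivAt [CompleteSpace F] {y y' : ℝ → F} {a b : ℝ}
    (hy : AbsolutelyContinuousOnInterval y a b) (hy' : IntervalIntegrable y' volume a b)
    (hd : ∀ᵐ x, x ∈ Set.uIcc a b → HasDerivAt y (y' x) x) {x : ℝ} (hx : x ∈ Set.uIcc a b) :
    y x = y a + ∫ t in a..x, y' t := by
  have hac : AbsolutelyContinuousOnInterval (y - fun x => ∫ t in a..x, y' t) a b :=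
    hy.sub (absolutelyContinuousOnInterval_integral hy')
  obtain ⟨c, hc⟩ := hac.const_of_ae_hasDerivAt_zero (by
    filter_upwards [hd, hy'.ae_hasDerivAt_integral] with x h1 h2 hx
    simpa using (h1 hx).sub (h2 hx a Set.left_mem_uIcc))
  have h1 := hc x hx
  have h2 := hc a Set.left_mem_uIcc
  simp only [Pi.sub_apply, intervalIntegral.integral_same, sub_zero] at h1 h2
  rw [← h2, sub_eq_iff_eq_add] at h1
  exact h1

end AbsolutelyContinuous

/-! ### The resolvent as an integral equation -/

section SolutionOperator

variable {n : ℕ} {b : Fin n → ℂ} {C D : Matrix (Fin n) (Fin n) ℂ}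
  {Q : ℝ → Matrix (Fin n) (Fin n) ℂ} {z : ℂ} {R : L2 n →L[ℂ] L2 n}

/-- Multiply `-i B⁻¹ y' + Q y = f + z y` by `iB` and integrate. The initial value `y 0` stays as an
unknown, to be removed later by `n` linear conditions. -/
theorem exists_solution (hb : ∀ j, b j ≠ 0) (hR : IsResolventAt (op b C D Q) z R) (f : L2 n) :
    ∃ y : ℝ → Fin n → ℂ, ContinuousOn y (Set.Icc 0 1) ∧
      (∀ᵐ x ∂unitVolume, (R f x).ofLp = y x) ∧
      ∀ x ∈ Set.Icc (0 : ℝ) 1, ∀ j, y x j = y 0 j + Complex.I * b j *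
        ∫ t in (0 : ℝ)..x, (f t j + (z * y t j - (Q t).mulVec (y t) j)) := by
  obtain ⟨hf, he⟩ := hR.1 f
  have hmem : (R f, f + z • R f) ∈ opGraph b C D Q := by
    rw [← graph_op, ← sub_eq_iff_eq_add.1 he]
    exact (op b C D Q).mem_graph ⟨R f, hf⟩
  obtain ⟨y, y', hy, -, h1, h2⟩ := hmem
  refine ⟨fun x => (y x).ofLp, ?_, ?_, ?_⟩
  · have : ContinuousOn y (Set.Icc 0 1) := by simpa using hy.absCont.continuousOn
    exact (PiLp.continuous_ofLp 2 _).comp_continuousOn this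
  · filter_upwards [h1] with x hx
    exact congrArg _ hx
  · intro x hx j
    have hder : ∀ᵐ x ∂unitVolume, y' x j = Complex.I * b j *
        (f x j + (z * y x j - (Q x).mulVec (y x).ofLp j)) := by
      filter_upwards [h1, h2, Lp.coeFn_add f (z • R f), Lp.coeFn_smul z (R f)] with x e1 e2 e3 e4
      rw [e3, Pi.add_apply, e4, Pi.smul_apply, e1] at e2
      have e5 := congrArg (fun v : EuclideanSpace ℂ (Fin n) => v j) e2
      have hinv : (Matrix.diagonal b)⁻¹ = Matrix.diagonal (fun i => (b i)⁻¹) := by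
        refine Matrix.inv_eq_right_inv ?_
        rw [Matrix.diagonal_mul_diagonal, ← Matrix.diagonal_one]
        congr 1
        ext i
        exact mul_inv_cancel₀ (hb i)
      simp only [diffExpr, hinv, Matrix.mulVec_diagonal, PiLp.add_apply, PiLp.smul_apply,
        Pi.add_apply, Pi.smul_apply, smul_eq_mul] at e5
      have e6 : f x j + (z * y x j - (Q x).mulVec (y x).ofLp j) =
          -Complex.I * ((b j)⁻¹ * y' x j) := by linear_combination e5
      rw [e6]
      have hbj := hb j
      field_simp
      rw [Complex.I_sq]
      ring
    have hac : AbsolutelyContinuousOnInterval (fun x => y x j) 0 1 :=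
      absolutelyContinuousOnInterval_of_dist_le hy.absCont fun x _ x' _ => by
        rw [dist_eq_norm, dist_eq_norm]
        exact PiLp.norm_apply_le (y x - y x') j
    have hy_int : IntervalIntegrable (fun x => y' x j) volume 0 1 := by
      rw [intervalIntegrable_iff_integrableOn_Icc_of_le zero_le_one]
      exact (EuclideanSpace.proj (𝕜 := ℂ) j).integrable_comp hy.integrable
    have hd : ∀ᵐ x, x ∈ Set.uIcc (0 : ℝ) 1 → HasDerivAt (fun x => y x j) (y' x j) x := by
      have := (ae_restrict_iff' measurableSet_Icc).1 hy.hasDeriv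
      rw [Set.uIcc_of_le zero_le_one]
      filter_upwards [this] with x hx hxm
      exact ((EuclideanSpace.proj (𝕜 := ℂ) j).restrictScalars ℝ).hasFDerivAt.comp_hasDerivAt x
        (hx hxm)
    refine (eq_add_integral_of_ae_hasDerivAt hac hy_int hd
      (by rwa [Set.uIcc_of_le zero_le_one])).trans ?_
    rw [← intervalIntegral.integral_const_mul]
    congr 1
    refine intervalIntegral.integral_congr_ae ?_
    filter_upwards [(ae_restrict_iff' measurableSet_Icc).1 hder] with t ht htm
    rw [Set.uIoc_of_le hx.1] at htm
    exact ht ⟨htm.1.le, htm.2.trans hx.2⟩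

theorem eqOn_of_ae_eq {y₁ y₂ : ℝ → Fin n → ℂ} (h₁ : ContinuousOn y₁ (Set.Icc 0 1))
    (h₂ : ContinuousOn y₂ (Set.Icc 0 1)) (h : y₁ =ᵐ[unitVolume] y₂) :
    Set.EqOn y₁ y₂ (Set.Icc 0 1) :=
  Measure.eqOn_Icc_of_ae_eq volume zero_ne_one h h₁ h₂

/-- The linear map taking `f` to the continuous representative of `R f`. -/
theorem exists_solution_linearMap (hb : ∀ j, b j ≠ 0) (hR : IsResolventAt (op b C D Q) z R) :
    ∃ Y : L2 n →ₗ[ℂ] (ℝ → Fin n → ℂ), ∀ f, ContinuousOn (Y f) (Set.Icc 0 1) ∧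
      (∀ᵐ x ∂unitVolume, (R f x).ofLp = Y f x) ∧
      ∀ x ∈ Set.Icc (0 : ℝ) 1, ∀ j, Y f x j = Y f 0 j + Complex.I * b j *
        ∫ t in (0 : ℝ)..x, (f t j + (z * Y f t j - (Q t).mulVec (Y f t) j)) := by
  classical
  choose y hy using exists_solution (Q := Q) hb hR
  let Y : L2 n →ₗ[ℂ] (ℝ → Fin n → ℂ) :=
    -- The continuous representative is unique only on `[0, 1]`; setting it to zero outside makes
    -- the choice linear on all of `ℝ`.
    { toFun := fun f => (Set.Icc (0 : ℝ) 1).indicator (y f)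
      map_add' := fun f g => by
        rw [← Set.indicator_add']
        refine Set.indicator_congr (eqOn_of_ae_eq (hy _).1 ((hy f).1.add (hy g).1) ?_)
        filter_upwards [(hy f).2.1, (hy g).2.1, (hy (f + g)).2.1, Lp.coeFn_add (R f) (R g)]
          with x h1 h2 h3 h4
        rw [← h3, map_add, h4, Pi.add_apply, Pi.add_apply, ← h1, ← h2, WithLp.ofLp_add]
      map_smul' := fun c f => by
        rw [RingHom.id_apply]
        refine (Set.indicator_congr (g := fun x => c • y f x) (eqOn_of_ae_eq (hy _).1 ((hy f).1.const_smul c) ?_)).trans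
            (Set.indicator_const_smul _ c (y f))
        filter_upwards [(hy f).2.1, (hy (c • f)).2.1, Lp.coeFn_smul c (R f)] with x h1 h2 h3
        rw [← h2, map_smul, h3, Pi.smul_apply, WithLp.ofLp_smul, h1] }
  have hY : ∀ f, Set.EqOn (Y f) (y f) (Set.Icc 0 1) := fun f x hx => Set.indicator_of_mem hx _
  refine ⟨Y, fun f => ⟨(hy f).1.congr (hY f), ?_, fun x hx j => ?_⟩⟩
  · filter_upwards [(hy f).2.1, ae_restrict_mem measurableSet_Icc] with x h1 hx
    rw [h1, hY f hx]
  · rw [hY f hx, hY f (Set.left_mem_Icc.2 zero_le_one), (hy f).2.2 x hx j]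
    congr 2
    refine intervalIntegral.integral_congr fun t ht => ?_
    rw [Set.uIcc_of_le hx.1] at ht
    simp only [hY f ⟨ht.1, ht.2.trans hx.2⟩]

end SolutionOperator

/-! ### Coordinates in `L²` and the leading term -/

section Coordinates

variable {n : ℕ}

theorem memLp_coord (f : L2 n) (j : Fin n) : MemLp (fun x => f x j) 2 unitVolume :=
  (EuclideanSpace.proj (𝕜 := ℂ) j).comp_memLp' (Lp.memLp f)

theorem intervalIntegrable_coord (f : L2 n) (j : Fin n) :
    IntervalIntegrable (fun x => f x j) volume 0 1 := by
  rw [intervalIntegrable_iff_integrableOn_Icc_of_le zero_le_one]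
  exact (memLp_coord f j).integrable one_le_two

theorem intervalIntegrable_norm_sq_coord (f : L2 n) (j : Fin n) :
    IntervalIntegrable (fun x => ‖f x j‖ ^ 2) volume 0 1 := by
  rw [intervalIntegrable_iff_integrableOn_Icc_of_le zero_le_one]
  exact (memLp_two_iff_integrable_sq_norm (memLp_coord f j).1).1 (memLp_coord f j)

theorem norm_sq_eq_sum_integral (f : L2 n) :
    ‖f‖ ^ 2 = ∑ j, ∫ x in (0 : ℝ)..1, ‖f x j‖ ^ 2 := by
  have h1 : ‖f‖ ^ 2 = ∫ x, ‖f x‖ ^ 2 ∂unitVolume := by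
    have h := congrArg RCLike.re (L2.inner_def (𝕜 := ℂ) f f)
    rw [← integral_re (L2.integrable_inner f f), ← norm_sq_eq_re_inner] at h
    simpa only [← norm_sq_eq_re_inner] using h
  rw [h1, integral_Icc_eq_integral_Ioc, ← intervalIntegral.integral_of_le zero_le_one,
    ← intervalIntegral.integral_finsetSum fun j _ => intervalIntegrable_norm_sq_coord f j]
  simp only [EuclideanSpace.norm_sq_eq]

theorem integral_norm_sq_coord_le (f : L2 n) (j : Fin n) :
    ∫ x in (0 : ℝ)..1, ‖f x j‖ ^ 2 ≤ ‖f‖ ^ 2 := by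
  rw [norm_sq_eq_sum_integral]
  exact Finset.single_le_sum (f := fun j => ∫ x in (0 : ℝ)..1, ‖f x j‖ ^ 2)
    (fun i _ => intervalIntegral.integral_nonneg zero_le_one fun x _ => by positivity)
    (Finset.mem_univ j)

/-- Cauchy–Schwarz. The factor `√(x - a)` supplies the additional half power of `k` in the
remainder. -/
theorem integral_norm_coord_le (f : L2 n) (j : Fin n) {a x : ℝ} (ha : 0 ≤ a) (hax : a ≤ x)
    (hx : x ≤ 1) : ∫ t in a..x, ‖f t j‖ ≤ Real.sqrt (x - a) * ‖f‖ := by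
  have hsub : Set.uIcc a x ⊆ Set.uIcc 0 1 := by
    rw [Set.uIcc_of_le hax, Set.uIcc_of_le zero_le_one]
    exact Set.Icc_subset_Icc ha hx
  have hi1 : IntervalIntegrable (fun t => ‖f t j‖) volume a x :=
    (intervalIntegrable_coord f j).norm.mono_set hsub
  have hi2 : IntervalIntegrable (fun t => ‖f t j‖ ^ 2) volume a x :=
    (intervalIntegrable_norm_sq_coord f j).mono_set hsub
  rcases hax.eq_or_lt with rfl | hlt
  · simp
  set I := ∫ t in a..x, ‖f t j‖ with hI
  have hF : ∫ t in a..x, ‖f t j‖ ^ 2 ≤ ‖f‖ ^ 2 := by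
    refine le_trans ?_ (integral_norm_sq_coord_le f j)
    exact intervalIntegral.integral_mono_interval ha hax hx
      (Eventually.of_forall fun t => by positivity) (intervalIntegrable_norm_sq_coord f j)
  have hL : 0 < x - a := sub_pos.2 hlt
  -- Expansion of the square of `‖f t j‖` minus its mean `I / (x - a)`.
  have hq : 0 ≤ ∫ t in a..x, (‖f t j‖ ^ 2 - 2 * (I / (x - a)) * ‖f t j‖ + (I / (x - a)) ^ 2) := by
    refine intervalIntegral.integral_nonneg hax fun t _ => ?_
    have := sq_nonneg (‖f t j‖ - I / (x - a))
    linarith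
  rw [intervalIntegral.integral_add (hi2.sub (hi1.const_mul _)) (by simp),
    intervalIntegral.integral_sub hi2 (hi1.const_mul _), intervalIntegral.integral_const_mul,
    ← hI, intervalIntegral.integral_const, smul_eq_mul] at hq
  have h1 : I ^ 2 / (x - a) ≤ ‖f‖ ^ 2 := by
    have h2 : 2 * (I / (x - a)) * I - (x - a) * (I / (x - a)) ^ 2 = I ^ 2 / (x - a) := by
      field_simp
      ring
    linarith
  rw [div_le_iff₀ hL] at h1
  refine le_of_sq_le_sq ?_ (by positivity)
  rw [mul_pow, Real.sq_sqrt hL.le]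
  linarith

theorem norm_le_of_ae_coord_bound (f : L2 n) {δ : ℝ} (hδ : 0 ≤ δ)
    (h : ∀ᵐ x ∂unitVolume, ∀ j, ‖f x j‖ ≤ δ) : ‖f‖ ≤ n * δ := by
  have h1 : ‖f‖ ≤ measureUnivNNReal unitVolume ^ (2 : ENNReal).toReal⁻¹ * (n * δ) := by
    refine Lp.norm_le_of_ae_bound (by positivity) ?_
    filter_upwards [h] with x hx
    refine le_of_sq_le_sq ?_ (by positivity)
    rw [EuclideanSpace.norm_sq_eq]
    calc ∑ j, ‖f x j‖ ^ 2 ≤ ∑ _j : Fin n, δ ^ 2 :=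
          Finset.sum_le_sum fun j _ => pow_le_pow_left₀ (norm_nonneg _) (hx j) 2
      _ = n * δ ^ 2 := by simp
      _ ≤ (n : ℝ) ^ 2 * δ ^ 2 := by
          gcongr
          exact_mod_cast Nat.le_self_pow two_ne_zero n
      _ = (n * δ) ^ 2 := by ring
  have h2 : measureUnivNNReal unitVolume = 1 := by
    simp [measureUnivNNReal]
  simpa [h2] using h1

theorem memLp_leadingTerm (b : Fin n → ℂ) (f : L2 n) :
    MemLp (fun x => (WithLp.toLp 2 fun j => Complex.I * b j * ∫ t in (0 : ℝ)..x, f t j :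
      EuclideanSpace ℂ (Fin n))) 2 unitVolume := by
  have hc : ContinuousOn (fun x => (WithLp.toLp 2 fun j =>
      Complex.I * b j * ∫ t in (0 : ℝ)..x, f t j : EuclideanSpace ℂ (Fin n))) (Set.Icc 0 1) := by
    refine (PiLp.continuous_toLp 2 _).comp_continuousOn (continuousOn_pi.2 fun j => ?_)
    have := intervalIntegral.continuousOn_primitive_interval' (intervalIntegrable_coord f j)
      Set.left_mem_uIcc
    rw [Set.uIcc_of_le zero_le_one] at this
    exact continuousOn_const.mul this
  obtain ⟨c, hc'⟩ := isCompact_Icc.exists_bound_of_continuousOn hc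
  refine MemLp.of_bound (hc.aestronglyMeasurable measurableSet_Icc) c ?_
  filter_upwards [ae_restrict_mem measurableSet_Icc] with x hx using hc' x hx

/-- The leading term `i B ∫₀ˣ f` of the resolvent. -/
noncomputable def leadingTerm (b : Fin n → ℂ) (f : L2 n) : L2 n := (memLp_leadingTerm b f).toLp _

theorem leadingTerm_ae (b : Fin n → ℂ) (f : L2 n) : ∀ᵐ x ∂unitVolume, ∀ j,
    leadingTerm b f x j = Complex.I * b j * ∫ t in (0 : ℝ)..x, f t j := by
  filter_upwards [(memLp_leadingTerm b f).coeFn_toLp] with x hx j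
  exact congrArg (fun v : EuclideanSpace ℂ (Fin n) => v j) hx

end Coordinates

/-! ### Grids of equal mass -/

section Grid

/-- Points of `[0, 1]` that divide the mass of `w` into `k` equal parts. -/
theorem exists_grid {w : ℝ → ℝ} (hw : IntervalIntegrable w volume 0 1) (hw1 : ∀ t, 1 ≤ w t)
    {k : ℕ} (hk : 0 < k) :
    ∃ g : Fin (k + 1) → ℝ, (∀ i, g i ∈ Set.Icc (0 : ℝ) 1) ∧
      ∀ t ∈ Set.Icc (0 : ℝ) 1, ∃ i, g i ≤ t ∧
        ∫ s in (g i)..t, w s ≤ (∫ s in (0 : ℝ)..1, w s) / k := by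
  set M := ∫ s in (0 : ℝ)..1, w s with hM
  have hsub : ∀ {a x : ℝ}, a ∈ Set.Icc (0 : ℝ) 1 → x ∈ Set.Icc (0 : ℝ) 1 →
      IntervalIntegrable w volume a x := fun ha hx => hw.mono_set (by
    rw [Set.uIcc_of_le (zero_le_one (α := ℝ))]
    exact Set.uIcc_subset_Icc ha hx)
  have h01 : (0 : ℝ) ∈ Set.Icc (0 : ℝ) 1 := Set.left_mem_Icc.2 zero_le_one
  have hgrow : ∀ {a x : ℝ}, a ∈ Set.Icc (0 : ℝ) 1 → x ∈ Set.Icc (0 : ℝ) 1 → a ≤ x →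
      x - a ≤ ∫ s in a..x, w s := fun {a x} ha hx hax => by
    have := intervalIntegral.integral_mono_on hax (μ := volume) (f := fun _ => (1 : ℝ)) (by simp)
      (hsub ha hx) fun s _ => hw1 s
    simpa using this
  have hMpos : 0 < M := by
    have := hgrow h01 (Set.right_mem_Icc.2 zero_le_one) zero_le_one
    linarith
  have hcont : ContinuousOn (fun x => ∫ s in (0 : ℝ)..x, w s) (Set.Icc 0 1) := by
    have := intervalIntegral.continuousOn_primitive_interval' hw Set.left_mem_uIcc
    rwa [Set.uIcc_of_le zero_le_one] at this
  have hk' : (0 : ℝ) < k := by exact_mod_cast hk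
  have hivt : ∀ i : Fin (k + 1), ∃ x ∈ Set.Icc (0 : ℝ) 1,
      ∫ s in (0 : ℝ)..x, w s = i * (M / k) := by
    intro i
    have hi : ((i : ℕ) : ℝ) ≤ k := by exact_mod_cast Nat.lt_succ_iff.1 i.2
    refine intermediate_value_Icc zero_le_one hcont ⟨?_, ?_⟩
    · simp only [intervalIntegral.integral_same]
      positivity
    · calc (i : ℝ) * (M / k) ≤ k * (M / k) := by gcongr
        _ = M := by field_simp
  choose g hg hgW using hivt
  refine ⟨g, hg, fun t ht => ?_⟩
  set Wt := ∫ s in (0 : ℝ)..t, w s with hWt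
  have hWt0 : 0 ≤ Wt := (sub_nonneg.2 ht.1).trans (hgrow h01 ht ht.1)
  have hWtM : Wt ≤ M := by
    have h1 := hgrow ht (Set.right_mem_Icc.2 zero_le_one) ht.2
    have h2 := intervalIntegral.integral_add_adjacent_intervals (hsub h01 ht)
      (hsub ht (Set.right_mem_Icc.2 zero_le_one))
    linarith [ht.2]
  -- The floor selects the last mass level not above `Wt`. Level `k` is attained when `Wt = M`,
  -- hence `k + 1` grid points.
  have hfl : ⌊Wt / (M / k)⌋₊ < k + 1 := by
    rw [Nat.lt_succ_iff]
    refine Nat.floor_le_of_le ?_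
    rw [div_le_iff₀ (by positivity)]
    calc Wt ≤ M := hWtM
      _ = k * (M / k) := by field_simp
  set i : Fin (k + 1) := ⟨⌊Wt / (M / k)⌋₊, hfl⟩ with hi
  have hlo : (i : ℝ) * (M / k) ≤ Wt := by
    rw [← le_div_iff₀ (by positivity)]
    exact Nat.floor_le (by positivity)
  have hhi : Wt < ((i : ℝ) + 1) * (M / k) := by
    rw [← div_lt_iff₀ (by positivity)]
    exact Nat.lt_floor_add_one _
  -- As `w ≥ 1`, the mass is strictly increasing, so an ordering of masses gives an ordering of
  -- points.
  have hit : g i ≤ t := by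
    by_contra! hlt
    have h1 := hgrow ht (hg i) hlt.le
    have h2 := intervalIntegral.integral_add_adjacent_intervals (hsub h01 ht) (hsub ht (hg i))
    rw [hgW] at h2
    linarith
  refine ⟨i, hit, ?_⟩
  have h2 := intervalIntegral.integral_add_adjacent_intervals (hsub h01 (hg i)) (hsub (hg i) ht)
  rw [hgW] at h2
  linarith

end Grid

/-! ### Comparison of the resolvent with its leading term -/

section Remainder

variable {n : ℕ} {b : Fin n → ℂ} {C D : Matrix (Fin n) (Fin n) ℂ}
  {Q : ℝ → Matrix (Fin n) (Fin n) ℂ} {z : ℂ} {R : L2 n →L[ℂ] L2 n}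

/-- A weight on `[0, 1]` that dominates the coefficients of the system. -/
noncomputable def weight (Q : ℝ → Matrix (Fin n) (Fin n) ℂ) (z : ℂ) (t : ℝ) : ℝ :=
  1 + ‖z‖ + ∑ j, ∑ l, ‖Q t j l‖

/-- The summand `1` makes mass dominate length, so that a cell of mass `μ` has length at most `μ`.
-/
theorem one_le_weight (t : ℝ) : 1 ≤ weight Q z t := by
  have : 0 ≤ ∑ j, ∑ l, ‖Q t j l‖ := by positivity
  have := norm_nonneg z
  unfold weight
  linarith

theorem intervalIntegrable_entry (hQ : ∀ j k, IntegrableOn (fun x => Q x j k) (Set.Icc (0 : ℝ) 1))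
    (j l : Fin n) : IntervalIntegrable (fun x => Q x j l) volume 0 1 :=
  (intervalIntegrable_iff_integrableOn_Icc_of_le zero_le_one).2 (hQ j l)

theorem intervalIntegrable_fun_sum {ι E : Type*} [NormedAddCommGroup E] (s : Finset ι)
    {g : ι → ℝ → E} {a b : ℝ} (h : ∀ i ∈ s, IntervalIntegrable (g i) volume a b) :
    IntervalIntegrable (fun t => ∑ i ∈ s, g i t) volume a b := by
  have := IntervalIntegrable.sum s h
  rwa [Finset.sum_fn] at this

theorem intervalIntegrable_weight
    (hQ : ∀ j k, IntegrableOn (fun x => Q x j k) (Set.Icc (0 : ℝ) 1)) :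
    IntervalIntegrable (weight Q z) volume 0 1 := by
  unfold weight
  refine IntervalIntegrable.add (by simp) ?_
  refine intervalIntegrable_fun_sum _ fun j _ => intervalIntegrable_fun_sum _ fun l _ => ?_
  exact (intervalIntegrable_entry hQ j l).norm

/-- The `j`-th component of `(z - Q) y`. -/
def perturbation (Q : ℝ → Matrix (Fin n) (Fin n) ℂ) (z : ℂ) (y : ℝ → Fin n → ℂ) (j : Fin n)
    (t : ℝ) : ℂ :=
  z * y t j - (Q t).mulVec (y t) j

theorem norm_perturbation_le (y : ℝ → Fin n → ℂ) (j : Fin n) (t : ℝ) :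
    ‖perturbation Q z y j t‖ ≤ weight Q z t * ‖y t‖ := by
  have h1 : ‖(Q t).mulVec (y t) j‖ ≤ (∑ l, ‖Q t j l‖) * ‖y t‖ := by
    rw [Matrix.mulVec, dotProduct, Finset.sum_mul]
    refine (norm_sum_le _ _).trans (Finset.sum_le_sum fun l _ => ?_)
    rw [norm_mul]
    gcongr
    exact norm_le_pi_norm _ l
  have h2 : ∑ l, ‖Q t j l‖ ≤ ∑ i, ∑ l, ‖Q t i l‖ :=
    Finset.single_le_sum (f := fun i => ∑ l, ‖Q t i l‖) (fun i _ => by positivity)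
      (Finset.mem_univ j)
  calc ‖perturbation Q z y j t‖ ≤ ‖z‖ * ‖y t j‖ + ‖(Q t).mulVec (y t) j‖ := by
        rw [← norm_mul]
        exact norm_sub_le _ _
    _ ≤ ‖z‖ * ‖y t‖ + (∑ l, ‖Q t j l‖) * ‖y t‖ := by
        gcongr
        exact norm_le_pi_norm _ j
    _ = (‖z‖ + ∑ l, ‖Q t j l‖) * ‖y t‖ := by ring
    _ ≤ weight Q z t * ‖y t‖ := by
        gcongr
        unfold weight
        linarith

theorem intervalIntegrable_perturbation
    (hQ : ∀ j k, IntegrableOn (fun x => Q x j k) (Set.Icc (0 : ℝ) 1)) {y : ℝ → Fin n → ℂ}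
    (hy : ContinuousOn y (Set.Icc 0 1)) (j : Fin n) {a x : ℝ} (ha : a ∈ Set.Icc (0 : ℝ) 1)
    (hx : x ∈ Set.Icc (0 : ℝ) 1) :
    IntervalIntegrable (perturbation Q z y j) volume a x := by
  have hyj : ∀ l, ContinuousOn (fun t => y t l) (Set.uIcc 0 1) := fun l => by
    rw [Set.uIcc_of_le zero_le_one]
    exact (continuous_apply l).comp_continuousOn hy
  have h01 : IntervalIntegrable (perturbation Q z y j) volume 0 1 := by
    unfold perturbation
    refine IntervalIntegrable.sub (ContinuousOn.intervalIntegrable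
      (continuousOn_const.mul (hyj j))) ?_
    simp only [Matrix.mulVec, dotProduct]
    exact intervalIntegrable_fun_sum _ fun l _ =>
      (intervalIntegrable_entry hQ j l).mul_continuousOn (hyj l)
  refine h01.mono_set ?_
  rw [Set.uIcc_of_le (zero_le_one (α := ℝ))]
  exact Set.uIcc_subset_Icc ha hx

variable {f : L2 n} {y : ℝ → Fin n → ℂ} {a x β μ : ℝ}

theorem norm_integral_perturbation_le
    (hQ : ∀ j k, IntegrableOn (fun x => Q x j k) (Set.Icc (0 : ℝ) 1))
    (ha : 0 ≤ a) (hax : a ≤ x) (hx : x ≤ 1)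
    (hμ : ∫ t in a..x, weight Q z t ≤ μ) {δ : ℝ} (hδ0 : 0 ≤ δ)
    (hδ : ∀ s ∈ Set.Icc a x, ‖y s‖ ≤ δ) (j : Fin n) :
    ‖∫ t in a..x, perturbation Q z y j t‖ ≤ μ * δ := by
  have hsub : Set.uIcc a x ⊆ Set.uIcc 0 1 := by
    rw [Set.uIcc_of_le hax, Set.uIcc_of_le zero_le_one]
    exact Set.Icc_subset_Icc ha hx
  have hw : IntervalIntegrable (weight Q z) volume a x :=
    (intervalIntegrable_weight hQ).mono_set hsub
  calc ‖∫ t in a..x, perturbation Q z y j t‖ ≤ ∫ t in a..x, weight Q z t * δ := by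
        refine intervalIntegral.norm_integral_le_of_norm_le hax ?_ (hw.mul_const δ)
        refine Eventually.of_forall fun t ht => (norm_perturbation_le y j t).trans ?_
        have := one_le_weight (Q := Q) (z := z) t
        gcongr
        exact hδ t ⟨ht.1.le, ht.2⟩
    _ = (∫ t in a..x, weight Q z t) * δ := intervalIntegral.integral_mul_const _ _
    _ ≤ μ * δ := by gcongr

/-- A solution that vanishes at `a` is small to the right of `a`. -/
theorem norm_solution_le (hQ : ∀ j k, IntegrableOn (fun x => Q x j k) (Set.Icc (0 : ℝ) 1))
    (hy : ContinuousOn y (Set.Icc 0 1))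
    (heq : ∀ x ∈ Set.Icc (0 : ℝ) 1, ∀ j, y x j = y 0 j + Complex.I * b j *
        ∫ t in (0 : ℝ)..x, (f t j + perturbation Q z y j t))
    (ha : 0 ≤ a) (hax : a ≤ x) (hx : x ≤ 1) (hya : y a = 0)
    (hβ : ∀ j, ‖b j‖ ≤ β) (hβ0 : 0 ≤ β) (hμ : ∫ t in a..x, weight Q z t ≤ μ)
    (hβμ : β * μ ≤ 1 / 2) {s : ℝ} (hs : s ∈ Set.Icc a x) :
    ‖y s‖ ≤ 2 * β * (Real.sqrt μ * ‖f‖) := by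
  -- In place of Gronwall: at a maximum `ξ` of `‖y‖` the perturbation contributes at most `βμ ‖y ξ‖
  -- ≤ ‖y ξ‖ / 2`, which is absorbed on the left.
  obtain ⟨ξ, hξ, hmax⟩ := isCompact_Icc.exists_isMaxOn (Set.nonempty_Icc.2 hax)
    (hy.norm.mono (Set.Icc_subset_Icc ha hx))
  have ha1 : a ∈ Set.Icc (0 : ℝ) 1 := ⟨ha, hax.trans hx⟩
  have hξ1 : ξ ∈ Set.Icc (0 : ℝ) 1 := ⟨ha.trans hξ.1, hξ.2.trans hx⟩
  have h00 : (0 : ℝ) ∈ Set.Icc (0 : ℝ) 1 := Set.left_mem_Icc.2 zero_le_one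
  have hf : ∀ j {c d : ℝ}, c ∈ Set.Icc (0 : ℝ) 1 → d ∈ Set.Icc (0 : ℝ) 1 →
      IntervalIntegrable (fun t => f t j) volume c d := fun j c d hc hd =>
    (intervalIntegrable_coord f j).mono_set (by
      rw [Set.uIcc_of_le (zero_le_one (α := ℝ))]
      exact Set.uIcc_subset_Icc hc hd)
  have hp := fun (j : Fin n) {c d : ℝ} (hc : c ∈ Set.Icc (0 : ℝ) 1) (hd : d ∈ Set.Icc (0 : ℝ) 1) =>
    intervalIntegrable_perturbation (z := z) hQ hy j hc hd
  have hw : ∀ {c d : ℝ}, c ∈ Set.Icc (0 : ℝ) 1 → d ∈ Set.Icc (0 : ℝ) 1 →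
      IntervalIntegrable (weight Q z) volume c d := fun hc hd =>
    (intervalIntegrable_weight hQ).mono_set (by
      rw [Set.uIcc_of_le (zero_le_one (α := ℝ))]
      exact Set.uIcc_subset_Icc hc hd)
  have hμξ : ∫ t in a..ξ, weight Q z t ≤ μ := by
    refine le_trans ?_ hμ
    exact intervalIntegral.integral_mono_interval le_rfl hξ.1 hξ.2
      (Eventually.of_forall fun t => zero_le_one.trans (one_le_weight t))
      (hw ha1 ⟨ha.trans hax, hx⟩)
  have hlen : ξ - a ≤ μ := by
    refine le_trans ?_ hμξ
    have := intervalIntegral.integral_mono_on hξ.1 (μ := volume) (f := fun _ => (1 : ℝ)) (by simp)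
      (hw ha1 hξ1) fun s _ => one_le_weight (Q := Q) (z := z) s
    simpa using this
  have hbound : ‖y ξ‖ ≤ β * (Real.sqrt μ * ‖f‖ + μ * ‖y ξ‖) := by
    have hμ0 : 0 ≤ μ := (sub_nonneg.2 hξ.1).trans hlen
    rw [pi_norm_le_iff_of_nonneg (by positivity)]
    intro j
    have hdiff : y ξ j = Complex.I * b j *
        ((∫ t in a..ξ, f t j) + ∫ t in a..ξ, perturbation Q z y j t) := by
      have h1 := heq ξ hξ1 j
      have h2 := heq a ha1 j
      rw [hya, Pi.zero_apply] at h2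
      rw [← intervalIntegral.integral_add (hf j ha1 hξ1) (hp j ha1 hξ1),
        ← intervalIntegral.integral_interval_sub_left
          ((hf j h00 hξ1).add (hp j h00 hξ1)) ((hf j h00 ha1).add (hp j h00 ha1))]
      linear_combination h1 - h2
    rw [hdiff, norm_mul, norm_mul, Complex.norm_I, one_mul]
    refine mul_le_mul (hβ j) ((norm_add_le _ _).trans (add_le_add ?_ ?_)) (norm_nonneg _) hβ0
    · refine (intervalIntegral.norm_integral_le_integral_norm hξ.1).trans ?_
      refine (integral_norm_coord_le f j ha hξ.1 (hξ.2.trans hx)).trans ?_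
      gcongr
    · exact norm_integral_perturbation_le hQ ha hξ.1 hξ1.2 hμξ (norm_nonneg _)
        (fun s hs => hmax ⟨hs.1, hs.2.trans hξ.2⟩) j
  have h3 : ‖y s‖ ≤ ‖y ξ‖ := hmax hs
  have h4 : β * μ * ‖y ξ‖ ≤ 1 / 2 * ‖y ξ‖ := by gcongr
  nlinarith

/-- The integral of the perturbation up to `x`, as a linear functional. -/
noncomputable def perturbationFunctional
    (hQ : ∀ j k, IntegrableOn (fun x => Q x j k) (Set.Icc (0 : ℝ) 1)) (z : ℂ)
    (Y : L2 n →ₗ[ℂ] (ℝ → Fin n → ℂ)) (hY : ∀ f, ContinuousOn (Y f) (Set.Icc 0 1))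
    (x : Set.Icc (0 : ℝ) 1) (j : Fin n) : L2 n →ₗ[ℂ] ℂ where
  toFun f := ∫ t in (0 : ℝ)..x, perturbation Q z (Y f) j t
  map_add' f g := by
    have h00 : (0 : ℝ) ∈ Set.Icc (0 : ℝ) 1 := Set.left_mem_Icc.2 zero_le_one
    rw [← intervalIntegral.integral_add
      (intervalIntegrable_perturbation hQ (hY f) j h00 x.2)
      (intervalIntegrable_perturbation hQ (hY g) j h00 x.2)]
    congr 1
    ext t
    simp only [perturbation, map_add, Pi.add_apply, Matrix.mulVec_add]
    ring
  map_smul' c f := by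
    rw [RingHom.id_apply, ← intervalIntegral.integral_smul]
    congr 1
    ext t
    simp only [perturbation, map_smul, Pi.smul_apply, Matrix.mulVec_smul, smul_eq_mul]
    ring

/-- On a subspace of codimension `O(k)` the resolvent is approximated by its leading term up to
`O(k ^ (-3 / 2))`. -/
theorem exists_remainder_bound (hb : ∀ j, b j ≠ 0)
    (hQ : ∀ j k, IntegrableOn (fun x => Q x j k) (Set.Icc (0 : ℝ) 1))
    (hR : IsResolventAt (op b C D Q) z R) :
    ∃ (c : ℝ) (k₀ : ℕ), 0 ≤ c ∧ ∀ k ≥ k₀,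
      ∃ Λ : L2 n →ₗ[ℂ] ((Option (Fin (k + 1)) ⊕ Fin (k + 1)) × Fin n → ℂ),
        ∀ f, Λ f = 0 → ‖R f - leadingTerm b f‖ ≤ c / (k * Real.sqrt k) * ‖f‖ := by
  obtain ⟨Y, hY⟩ := exists_solution_linearMap hb hR
  set β := ∑ j, ‖b j‖ with hβdef
  have hβ0 : 0 ≤ β := by positivity
  have hβ : ∀ j, ‖b j‖ ≤ β := fun j =>
    Finset.single_le_sum (f := fun j => ‖b j‖) (fun i _ => norm_nonneg _) (Finset.mem_univ j)
  have hw := intervalIntegrable_weight (z := z) hQ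
  set M := ∫ s in (0 : ℝ)..1, weight Q z s with hM
  have hM0 : 0 ≤ M := intervalIntegral.integral_nonneg zero_le_one fun t _ =>
    zero_le_one.trans (one_le_weight t)
  obtain ⟨k₁, hk₁⟩ := exists_nat_ge (2 * (β * M))
  -- `k₁` ensures `β M / k ≤ 1/2`, and the `+ 1` ensures `k > 0`. The factor `n` comes from
  -- `norm_le_of_ae_coord_bound`.
  refine ⟨n * (2 * β * β * (M * Real.sqrt M)), k₁ + 1, by positivity, fun k hk => ?_⟩
  have hkpos : 0 < k := by omega
  have hk' : (0 : ℝ) < k := by exact_mod_cast hkpos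
  have hkβ : β * (M / k) ≤ 1 / 2 := by
    have : (k₁ : ℝ) ≤ k := by exact_mod_cast (by omega : k₁ ≤ k)
    rw [← mul_div_assoc, div_le_iff₀ hk']
    linarith
  obtain ⟨g, hg, hgrid⟩ := exists_grid hw one_le_weight hkpos
  let ev : ℝ → Fin n → L2 n →ₗ[ℂ] ℂ := fun x j =>
    LinearMap.proj j ∘ₗ LinearMap.proj x ∘ₗ Y
  -- `none` evaluates the solution at `0`, `some i` at the grid point `g i`; the right summand holds
  -- the integrals of the perturbation up to `g i`.
  let Λ : L2 n →ₗ[ℂ] ((Option (Fin (k + 1)) ⊕ Fin (k + 1)) × Fin n → ℂ) :=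
    LinearMap.pi fun q => Sum.elim (fun o => ev (o.elim 0 g) q.2)
      (fun i => perturbationFunctional hQ z Y (fun f => (hY f).1) ⟨g i, hg i⟩ q.2) q.1
  refine ⟨Λ, fun f hf => ?_⟩
  obtain ⟨hcont, hae, heq⟩ := hY f
  have hy0 : Y f 0 = 0 := funext fun j => congrFun hf (Sum.inl none, j)
  have hyg : ∀ i, Y f (g i) = 0 := fun i => funext fun j => congrFun hf (Sum.inl (some i), j)
  have hpg : ∀ i j, ∫ t in (0 : ℝ)..g i, perturbation Q z (Y f) j t = 0 := fun i j =>
    congrFun hf (Sum.inr i, j)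
  have hpt : ∀ x ∈ Set.Icc (0 : ℝ) 1, ∀ j,
      ‖Y f x j - Complex.I * b j * ∫ t in (0 : ℝ)..x, f t j‖ ≤
        2 * β * β * (M / k * Real.sqrt (M / k)) * ‖f‖ := by
    intro x hx j
    have h00 : (0 : ℝ) ∈ Set.Icc (0 : ℝ) 1 := Set.left_mem_Icc.2 zero_le_one
    obtain ⟨i, hix, hmass⟩ := hgrid x hx
    have hfx : IntervalIntegrable (fun t => f t j) volume 0 x :=
      (intervalIntegrable_coord f j).mono_set (by
        rw [Set.uIcc_of_le (zero_le_one (α := ℝ))]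
        exact Set.uIcc_subset_Icc h00 hx)
    have hp := fun {c d : ℝ} (hc : c ∈ Set.Icc (0 : ℝ) 1) (hd : d ∈ Set.Icc (0 : ℝ) 1) =>
      intervalIntegrable_perturbation (z := z) hQ hcont j hc hd
    -- The linear conditions remove `y(0)` and the integral up to `g i`; only part of one cell is
    -- left, of mass at most `M / k`.
    have h1 : Y f x j - Complex.I * b j * ∫ t in (0 : ℝ)..x, f t j =
        Complex.I * b j * ∫ t in (g i)..x, perturbation Q z (Y f) j t := by
      have h2 := heq x hx j
      have h3 := intervalIntegral.integral_add hfx (hp h00 hx)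
      have h4 := intervalIntegral.integral_add_adjacent_intervals (hp h00 (hg i)) (hp (hg i) hx)
      rw [hpg, zero_add] at h4
      rw [h4, h2, hy0, Pi.zero_apply]
      unfold perturbation at h3 ⊢
      rw [h3]
      ring
    have h5 := norm_integral_perturbation_le (y := Y f) hQ (hg i).1 hix hx.2 hmass
      (δ := 2 * β * (Real.sqrt (M / k) * ‖f‖)) (by positivity)
      (fun s hs => norm_solution_le hQ hcont heq (hg i).1 hix hx.2 (hyg i) hβ hβ0 hmass hkβ hs) j
    rw [h1, norm_mul, norm_mul, Complex.norm_I, one_mul]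
    calc ‖b j‖ * ‖∫ t in (g i)..x, perturbation Q z (Y f) j t‖
        ≤ β * (M / k * (2 * β * (Real.sqrt (M / k) * ‖f‖))) :=
          mul_le_mul (hβ j) h5 (norm_nonneg _) hβ0
      _ = _ := by ring
  have hfinal := norm_le_of_ae_coord_bound (R f - leadingTerm b f)
    (δ := 2 * β * β * (M / k * Real.sqrt (M / k)) * ‖f‖) (by positivity) (by
      filter_upwards [hae, leadingTerm_ae b f, Lp.coeFn_sub (R f) (leadingTerm b f),
        ae_restrict_mem measurableSet_Icc] with x e1 e2 e3 hx j
      rw [e3, Pi.sub_apply, PiLp.sub_apply, e2 j, e1]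
      exact hpt x hx j)
  refine hfinal.trans (le_of_eq ?_)
  rw [Real.sqrt_div hM0]
  have : Real.sqrt k ≠ 0 := by positivity
  field_simp

end Remainder

/-! ### Fourier coefficients of primitives -/

section Fourier

/-- The exponential `e^{2πikx}`. -/
noncomputable def expMode (k : ℤ) (x : ℝ) : ℂ := Complex.exp (2 * Real.pi * Complex.I * k * x)

theorem continuous_expMode (k : ℤ) : Continuous (expMode k) := by
  unfold expMode
  fun_prop

theorem hasDerivAt_expMode (k : ℤ) (x : ℝ) :
    HasDerivAt (expMode k) (2 * Real.pi * Complex.I * k * expMode k x) x := by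
  have h := ((hasDerivAt_id (x : ℂ)).const_mul (2 * Real.pi * Complex.I * k)).cexp.comp_ofReal
  simp only [id_eq, mul_one] at h
  unfold expMode
  convert h using 1
  ring

theorem expMode_zero_left (x : ℝ) : expMode 0 x = 1 := by simp [expMode]

theorem expMode_zero (k : ℤ) : expMode k 0 = 1 := by simp [expMode]

theorem expMode_one (k : ℤ) : expMode k 1 = 1 := by
  rw [expMode, Complex.exp_eq_one_iff]
  exact ⟨k, by push_cast; ring⟩

theorem expMode_mul (k l : ℤ) (x : ℝ) : expMode k x * expMode l x = expMode (k + l) x := by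
  rw [expMode, expMode, expMode, ← Complex.exp_add]
  congr 1
  push_cast
  ring

theorem two_pi_I_mul_ne_zero {k : ℤ} (hk : k ≠ 0) : (2 * Real.pi * Complex.I * k : ℂ) ≠ 0 := by
  have := Real.pi_ne_zero
  simp [hk]

theorem integral_expMode {k : ℤ} (hk : k ≠ 0) : ∫ x in (0 : ℝ)..1, expMode k x = 0 := by
  have h0 := two_pi_I_mul_ne_zero hk
  have h := intervalIntegral.integral_eq_sub_of_hasDerivAt (a := 0) (b := 1)
    (f := expMode k) (fun x _ => hasDerivAt_expMode k x)
    (by exact ((continuous_expMode k).const_mul _).intervalIntegrable _ _)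
  rw [intervalIntegral.integral_const_mul, expMode_one, expMode_zero, sub_self] at h
  exact (mul_eq_zero.1 h).resolve_left h0

/-- The Fourier coefficients of a function on `[0, 1]`. -/
noncomputable def fourierCoeffUnit (g : ℝ → ℂ) (k : ℤ) : ℂ :=
  ∫ x in (0 : ℝ)..1, expMode (-k) x * g x

theorem fourierCoeffUnit_eq (g : ℝ → ℂ) (k : ℤ) :
    fourierCoeffUnit g k = fourierCoeffOn zero_lt_one g k := by
  rw [fourierCoeffOn_eq_integral, fourierCoeffUnit]
  simp only [sub_zero, div_one, one_smul, smul_eq_mul]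
  congr 1
  ext x
  congr 1
  rw [expMode, fourier_coe_apply]
  congr 1
  push_cast
  ring

theorem fourierCoeffUnit_zero (g : ℝ → ℂ) : fourierCoeffUnit g 0 = ∫ x in (0 : ℝ)..1, g x := by
  simp [fourierCoeffUnit, expMode_zero_left]

theorem hasSum_sq_fourierCoeffUnit {g : ℝ → ℂ} (hg : MemLp g 2 unitVolume) :
    HasSum (fun k => ‖fourierCoeffUnit g k‖ ^ 2) (∫ x in (0 : ℝ)..1, ‖g x‖ ^ 2) := by
  have h := hasSum_sq_fourierCoeffOn (f := g) zero_lt_one (by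
    rwa [restrict_Ioc_eq_restrict_Icc])
  simpa [fourierCoeffUnit_eq] using h

/-- Integration by parts; the boundary terms vanish because the primitive is `0` at `0` and equals
the zeroth coefficient of `g`, also `0`, at `1`. -/
theorem fourierCoeffUnit_primitive {g : ℝ → ℂ} (hg : IntervalIntegrable g volume 0 1)
    (h0 : fourierCoeffUnit g 0 = 0) {k : ℤ} (hk : k ≠ 0) :
    fourierCoeffUnit (fun x => ∫ t in (0 : ℝ)..x, g t) k =
      fourierCoeffUnit g k / (2 * Real.pi * Complex.I * k) := by
  rw [fourierCoeffUnit_zero] at h0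
  set G : ℝ → ℂ := fun x => ∫ t in (0 : ℝ)..x, g t with hG
  have hGac : AbsolutelyContinuousOnInterval G 0 1 := absolutelyContinuousOnInterval_integral hg
  have heac : AbsolutelyContinuousOnInterval (expMode (-k)) 0 1 := by
    refine ContDiffOn.absolutelyContinuousOnInterval (ContDiff.contDiffOn ?_)
    unfold expMode
    exact (contDiff_const.mul Complex.ofRealCLM.contDiff).cexp
  have hi1 : IntervalIntegrable (fun x => expMode (-k) x * G x) volume 0 1 :=
    ContinuousOn.intervalIntegrable ((continuous_expMode _).continuousOn.mul hGac.continuousOn)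
  have hi2 : IntervalIntegrable (fun x => expMode (-k) x * g x) volume 0 1 :=
    hg.continuousOn_mul (continuous_expMode _).continuousOn
  have h := eq_add_integral_of_ae_hasDerivAt (y := fun x => expMode (-k) x * G x)
    (y' := fun x => 2 * Real.pi * Complex.I * (-k : ℤ) * (expMode (-k) x * G x) +
      expMode (-k) x * g x) (a := 0) (b := 1) (heac.smul hGac) ((hi1.const_mul _).add hi2) (by
        filter_upwards [hg.ae_hasDerivAt_integral] with x hx hxm
        have := (hasDerivAt_expMode (-k) x).mul (hx hxm 0 Set.left_mem_uIcc)
        rw [mul_assoc (2 * Real.pi * Complex.I * _)] at this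
        exact this) (x := 1) Set.right_mem_uIcc
  rw [intervalIntegral.integral_add (hi1.const_mul _) hi2,
    intervalIntegral.integral_const_mul] at h
  have hG0 : G 0 = 0 := intervalIntegral.integral_same
  have hG1 : G 1 = 0 := h0
  rw [hG0, hG1] at h
  rw [eq_div_iff (two_pi_I_mul_ne_zero hk)]
  unfold fourierCoeffUnit
  push_cast at h
  linear_combination h

theorem memLp_primitive {g : ℝ → ℂ} (hg : IntervalIntegrable g volume 0 1) :
    MemLp (fun x => ∫ t in (0 : ℝ)..x, g t) 2 unitVolume := by
  have hc := intervalIntegral.continuousOn_primitive_interval' hg Set.left_mem_uIcc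
  rw [Set.uIcc_of_le zero_le_one] at hc
  obtain ⟨c, hc'⟩ := isCompact_Icc.exists_bound_of_continuousOn hc
  refine MemLp.of_bound (hc.aestronglyMeasurable measurableSet_Icc) c ?_
  filter_upwards [ae_restrict_mem measurableSet_Icc] with x hx using hc' x hx

theorem intervalIntegrable_of_memLp {g : ℝ → ℂ} (hg : MemLp g 2 unitVolume) :
    IntervalIntegrable g volume 0 1 := by
  rw [intervalIntegrable_iff_integrableOn_Icc_of_le zero_le_one]
  exact hg.integrable one_le_two

theorem norm_sq_fourierCoeffUnit_primitive {g : ℝ → ℂ} (hg : IntervalIntegrable g volume 0 1)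
    (h0 : fourierCoeffUnit g 0 = 0) {k : ℤ} (hk : k ≠ 0) :
    ‖fourierCoeffUnit (fun x => ∫ t in (0 : ℝ)..x, g t) k‖ ^ 2 =
      (1 / (2 * Real.pi * |(k : ℝ)|)) ^ 2 * ‖fourierCoeffUnit g k‖ ^ 2 := by
  rw [fourierCoeffUnit_primitive hg h0 hk, norm_div]
  have : ‖(2 * Real.pi * Complex.I * k : ℂ)‖ = 2 * Real.pi * |(k : ℝ)| := by
    simp [abs_of_pos Real.pi_pos]
  rw [this]
  ring

/-- Parseval, mode by mode. The mean of the primitive is not determined by the coefficient of `g` of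
the same index, so its vanishing is a separate hypothesis. -/
theorem integral_norm_sq_primitive_le {g : ℝ → ℂ} (hg : MemLp g 2 unitVolume) {ρ : ℝ}
    (hρ : 0 < ρ) (h : ∀ k : ℤ, fourierCoeffUnit g k ≠ 0 → ρ ≤ |(k : ℝ)|)
    (hG : ∫ x in (0 : ℝ)..1, ∫ t in (0 : ℝ)..x, g t = 0) :
    ∫ x in (0 : ℝ)..1, ‖∫ t in (0 : ℝ)..x, g t‖ ^ 2 ≤
      (1 / (2 * Real.pi * ρ)) ^ 2 * ∫ x in (0 : ℝ)..1, ‖g x‖ ^ 2 := by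
  have hpi := Real.pi_pos
  have hi := intervalIntegrable_of_memLp hg
  have h0 : fourierCoeffUnit g 0 = 0 := by
    by_contra hne
    have := h 0 hne
    simp at this
    linarith
  refine hasSum_le (fun k => ?_) (hasSum_sq_fourierCoeffUnit (memLp_primitive hi))
    ((hasSum_sq_fourierCoeffUnit hg).mul_left _)
  rcases eq_or_ne k 0 with rfl | hk
  · rw [fourierCoeffUnit_zero, hG, h0]
    simp
  · rw [norm_sq_fourierCoeffUnit_primitive hi h0 hk]
    by_cases hz : fourierCoeffUnit g k = 0
    · simp [hz]
    · have := h k hz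
      gcongr

/-- For the lower bound the mean of the primitive only helps, so no condition on it is needed. -/
theorem le_integral_norm_sq_primitive {g : ℝ → ℂ} (hg : MemLp g 2 unitVolume) {ρ : ℝ}
    (h : ∀ k : ℤ, fourierCoeffUnit g k ≠ 0 → k ≠ 0 ∧ |(k : ℝ)| ≤ ρ) :
    (1 / (2 * Real.pi * ρ)) ^ 2 * ∫ x in (0 : ℝ)..1, ‖g x‖ ^ 2 ≤
      ∫ x in (0 : ℝ)..1, ‖∫ t in (0 : ℝ)..x, g t‖ ^ 2 := by
  have hpi := Real.pi_pos
  have hi := intervalIntegrable_of_memLp hg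
  have h0 : fourierCoeffUnit g 0 = 0 := by
    by_contra hne
    exact (h 0 hne).1 rfl
  refine hasSum_le (fun k => ?_) ((hasSum_sq_fourierCoeffUnit hg).mul_left _)
    (hasSum_sq_fourierCoeffUnit (memLp_primitive hi))
  by_cases hz : fourierCoeffUnit g k = 0
  · rw [hz]
    simp only [norm_zero, ne_eq, OfNat.ofNat_ne_zero, not_false_eq_true, zero_pow, mul_zero]
    positivity
  · obtain ⟨hk, hkρ⟩ := h k hz
    rw [norm_sq_fourierCoeffUnit_primitive hi h0 hk]
    have : 0 < |(k : ℝ)| := abs_pos.2 (by exact_mod_cast hk)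
    have hρ : 0 < ρ := this.trans_le hkρ
    gcongr

end Fourier

/-! ### Two-sided bounds for the leading term -/

section LeadingTerm

variable {n : ℕ} {b : Fin n → ℂ}

theorem norm_sq_leadingTerm (f : L2 n) : ‖leadingTerm b f‖ ^ 2 =
    ∑ j, ‖b j‖ ^ 2 * ∫ x in (0 : ℝ)..1, ‖∫ t in (0 : ℝ)..x, f t j‖ ^ 2 := by
  rw [norm_sq_eq_sum_integral]
  refine Finset.sum_congr rfl fun j _ => ?_
  rw [← intervalIntegral.integral_const_mul]
  refine intervalIntegral.integral_congr_ae_restrict ?_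
  rw [Set.uIoc_of_le zero_le_one, restrict_Ioc_eq_restrict_Icc]
  filter_upwards [leadingTerm_ae b f] with x hx
  rw [hx j, norm_mul, norm_mul, Complex.norm_I, one_mul, mul_pow]

/-- The functional `f ↦ ∫₀ˣ φ f_j`. -/
noncomputable def coordFunctional {φ : ℝ → ℂ} (hφ : Continuous φ) (j : Fin n)
    (x : Set.Icc (0 : ℝ) 1) : L2 n →ₗ[ℂ] ℂ where
  toFun f := ∫ t in (0 : ℝ)..x, φ t * f t j
  map_add' f g := by
    have hi : ∀ f : L2 n, IntervalIntegrable (fun t => φ t * f t j) volume 0 x := fun f =>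
      ((intervalIntegrable_coord f j).continuousOn_mul hφ.continuousOn).mono_set (by
        rw [Set.uIcc_of_le (zero_le_one (α := ℝ)), Set.uIcc_of_le x.2.1]
        exact Set.Icc_subset_Icc le_rfl x.2.2)
    rw [← intervalIntegral.integral_add (hi f) (hi g)]
    refine intervalIntegral.integral_congr_ae ?_
    filter_upwards [(ae_restrict_iff' measurableSet_Icc).1 (Lp.coeFn_add f g)] with t ht htm
    rw [Set.uIoc_of_le x.2.1] at htm
    rw [ht ⟨htm.1.le, htm.2.trans x.2.2⟩, Pi.add_apply, PiLp.add_apply, mul_add]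
  map_smul' c f := by
    rw [RingHom.id_apply, ← intervalIntegral.integral_smul]
    refine intervalIntegral.integral_congr_ae ?_
    filter_upwards [(ae_restrict_iff' measurableSet_Icc).1 (Lp.coeFn_smul c f)] with t ht htm
    rw [Set.uIoc_of_le x.2.1] at htm
    rw [ht ⟨htm.1.le, htm.2.trans x.2.2⟩, Pi.smul_apply, PiLp.smul_apply, smul_eq_mul,
      smul_eq_mul, mul_left_comm]

/-- The `k`-th Fourier coefficient of the `j`-th coordinate. -/
noncomputable def fourierFunctional (j : Fin n) (k : ℤ) : L2 n →ₗ[ℂ] ℂ :=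
  coordFunctional (continuous_expMode (-k)) j ⟨1, Set.right_mem_Icc.2 zero_le_one⟩

theorem fourierFunctional_apply (j : Fin n) (k : ℤ) (f : L2 n) :
    fourierFunctional j k f = fourierCoeffUnit (fun x => f x j) k := rfl

/-- The mean of the primitive of the `j`-th coordinate. -/
noncomputable def primitiveMean (j : Fin n) : L2 n →ₗ[ℂ] ℂ where
  toFun f := ∫ x in (0 : ℝ)..1, ∫ t in (0 : ℝ)..x, f t j
  map_add' f g := by
    have hi : ∀ f : L2 n, IntervalIntegrable (fun x => ∫ t in (0 : ℝ)..x, f t j) volume 0 1 :=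
      fun f => intervalIntegrable_of_memLp (memLp_primitive (intervalIntegrable_coord f j))
    rw [← intervalIntegral.integral_add (hi f) (hi g)]
    refine intervalIntegral.integral_congr fun x hx => ?_
    rw [Set.uIcc_of_le zero_le_one] at hx
    simpa [coordFunctional] using
      (coordFunctional (n := n) (continuous_const (y := (1 : ℂ))) j ⟨x, hx⟩).map_add f g
  map_smul' c f := by
    rw [RingHom.id_apply, ← intervalIntegral.integral_smul]
    refine intervalIntegral.integral_congr fun x hx => ?_
    rw [Set.uIcc_of_le zero_le_one] at hx
    have h := (coordFunctional (n := n) (continuous_const (y := (1 : ℂ))) j ⟨x, hx⟩).map_smul c f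
    simpa only [coordFunctional, LinearMap.coe_mk, AddHom.coe_mk, one_mul] using h

/-- Upper bound for the leading term on a subspace of finite codimension. -/
theorem exists_leadingTerm_le (hb : ∀ j, b j ≠ 0) {X : ℝ} (hX : 0 < X) :
    ∃ Λ : L2 n →ₗ[ℂ] ((Σ j : Fin n, Option (Finset.Icc (-(⌊‖b j‖ * X⌋₊ : ℤ)) ⌊‖b j‖ * X⌋₊)) → ℂ),
      ∀ f, Λ f = 0 → ‖leadingTerm b f‖ ≤ 1 / (2 * Real.pi * X) * ‖f‖ := by
  have hpi := Real.pi_pos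
  -- The cutoff `|k| ≤ |b_j| X` depends on `j` so that `|b_j|` cancels and every coordinate gets the
  -- same factor `1 / (2πX)`.
  refine ⟨LinearMap.pi fun q => q.2.elim (primitiveMean q.1) fun k => fourierFunctional q.1 k,
    fun f hf => ?_⟩
  refine le_of_sq_le_sq ?_ (by positivity)
  rw [norm_sq_leadingTerm, mul_pow, norm_sq_eq_sum_integral f, Finset.mul_sum]
  refine Finset.sum_le_sum fun j _ => ?_
  have hbj : 0 < ‖b j‖ := norm_pos_iff.2 (hb j)
  have h := integral_norm_sq_primitive_le (memLp_coord f j) (mul_pos hbj hX) (fun k hk => by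
    by_contra! hlt
    refine hk (congrFun hf ⟨j, some ⟨k, ?_⟩⟩)
    have h1 : k.natAbs ≤ ⌊‖b j‖ * X⌋₊ := by
      refine Nat.le_floor ?_
      rw [Nat.cast_natAbs, Int.cast_abs]
      exact hlt.le
    rw [Finset.mem_Icc]
    omega) (congrFun hf ⟨j, none⟩)
  calc ‖b j‖ ^ 2 * ∫ x in (0 : ℝ)..1, ‖∫ t in (0 : ℝ)..x, f t j‖ ^ 2
      ≤ ‖b j‖ ^ 2 * ((1 / (2 * Real.pi * (‖b j‖ * X))) ^ 2 * ∫ x in (0 : ℝ)..1, ‖f x j‖ ^ 2) := by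
        gcongr
    _ = _ := by
        field_simp

theorem memLp_single_expMode (j : Fin n) (k : ℤ) :
    MemLp (fun x => (EuclideanSpace.single j (expMode k x) : EuclideanSpace ℂ (Fin n))) 2
      unitVolume := by
  have hc : Continuous fun x =>
      (EuclideanSpace.single j (expMode k x) : EuclideanSpace ℂ (Fin n)) :=
    (PiLp.continuous_toLp 2 _).comp ((continuous_single j).comp (continuous_expMode k))
  obtain ⟨c, hc'⟩ := (isCompact_Icc (a := (0 : ℝ)) (b := 1)).exists_bound_of_continuousOn
    hc.continuousOn
  refine MemLp.of_bound hc.aestronglyMeasurable c ?_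
  filter_upwards [ae_restrict_mem measurableSet_Icc] with x hx using hc' x hx

/-- The exponential `e^{2πikx}` in the `j`-th coordinate. -/
noncomputable def modeVector (j : Fin n) (k : ℤ) : L2 n := (memLp_single_expMode j k).toLp _

theorem fourierFunctional_modeVector (i j : Fin n) (k l : ℤ) :
    fourierFunctional i l (modeVector j k) = if i = j ∧ l = k then 1 else 0 := by
  rw [fourierFunctional_apply, fourierCoeffUnit]
  have h : ∫ x in (0 : ℝ)..1, expMode (-l) x * (modeVector j k : L2 n) x i =
      ∫ x in (0 : ℝ)..1, expMode (-l) x * (if i = j then expMode k x else 0) := by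
    refine intervalIntegral.integral_congr_ae_restrict ?_
    rw [Set.uIoc_of_le zero_le_one, restrict_Ioc_eq_restrict_Icc]
    filter_upwards [(memLp_single_expMode j k).coeFn_toLp] with x hx
    rw [modeVector, hx]
    simp
  rw [h]
  by_cases hij : i = j
  · simp only [hij, if_true, true_and, expMode_mul]
    split_ifs with hkl
    · simp [hkl, expMode_zero_left]
    · exact integral_expMode (by omega)
  · simp [hij]

/-- Lower bound for the leading term on a subspace of finite dimension. -/
theorem exists_le_leadingTerm (hb : ∀ j, b j ≠ 0) {X : ℝ} (hX : 0 < X) :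
    ∃ V : Submodule ℂ (L2 n), FiniteDimensional ℂ V ∧
      Module.finrank ℂ V = ∑ j, 2 * ⌊‖b j‖ * X⌋₊ ∧
      ∀ f ∈ V, 1 / (2 * Real.pi * X) * ‖f‖ ≤ ‖leadingTerm b f‖ := by
  classical
  have hpi := Real.pi_pos
  -- Frequency `0` is excluded since the primitive of a constant mode is not periodic; `2 ⌊|b_j| X⌋`
  -- modes remain per coordinate.
  let ι := Σ j : Fin n, (Finset.Icc (-(⌊‖b j‖ * X⌋₊ : ℤ)) ⌊‖b j‖ * X⌋₊).erase 0
  let e : ι → L2 n := fun q => modeVector q.1 q.2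
  have hli : LinearIndependent ℂ e := by
    rw [Fintype.linearIndependent_iff]
    intro c hc q
    have h := congrArg (fourierFunctional q.1 (q.2 : ℤ)) hc
    rw [map_sum, map_zero, Finset.sum_eq_single q] at h
    · simpa [e, fourierFunctional_modeVector] using h
    · rintro ⟨j, k⟩ - hne
      rw [map_smul, fourierFunctional_modeVector, if_neg, smul_zero]
      rintro ⟨h1, h2⟩
      obtain ⟨j', k'⟩ := q
      simp only at h1 h2
      subst h1
      exact hne (by rw [Subtype.ext h2])
    · intro h
      exact absurd (Finset.mem_univ q) h
  refine ⟨Submodule.span ℂ (Set.range e),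
    FiniteDimensional.span_of_finite ℂ (Set.finite_range e), ?_, fun f hf => ?_⟩
  · rw [finrank_span_eq_card hli, Fintype.card_sigma]
    refine Finset.sum_congr rfl fun j _ => ?_
    rw [Fintype.card_coe, Finset.card_erase_of_mem (by simp), Int.card_Icc]
    omega
  · have hcoef : ∀ j k, fourierFunctional j k f ≠ 0 →
        k ≠ 0 ∧ |(k : ℝ)| ≤ ‖b j‖ * X := by
      intro j k hne
      by_contra hnot
      refine hne ?_
      have hle : Submodule.span ℂ (Set.range e) ≤ LinearMap.ker (fourierFunctional j k) := by
        rw [Submodule.span_le]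
        rintro _ ⟨⟨i, l, hl⟩, rfl⟩
        rw [SetLike.mem_coe, LinearMap.mem_ker, fourierFunctional_modeVector, if_neg]
        rintro ⟨rfl, rfl⟩
        rw [Finset.mem_erase, Finset.mem_Icc] at hl
        refine hnot ⟨hl.1, ?_⟩
        have h1 : k.natAbs ≤ ⌊‖b j‖ * X⌋₊ := by omega
        have h2 := (Nat.le_floor_iff (by positivity)).1 h1
        rwa [Nat.cast_natAbs, Int.cast_abs] at h2
      exact hle hf
    refine le_of_sq_le_sq ?_ (norm_nonneg _)
    rw [norm_sq_leadingTerm, mul_pow, norm_sq_eq_sum_integral f, Finset.mul_sum]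
    refine Finset.sum_le_sum fun j _ => ?_
    have hbj : 0 < ‖b j‖ := norm_pos_iff.2 (hb j)
    have h := le_integral_norm_sq_primitive (memLp_coord f j) (hcoef j)
    calc (1 / (2 * Real.pi * X)) ^ 2 * ∫ x in (0 : ℝ)..1, ‖f x j‖ ^ 2
        = ‖b j‖ ^ 2 * ((1 / (2 * Real.pi * (‖b j‖ * X))) ^ 2 *
            ∫ x in (0 : ℝ)..1, ‖f x j‖ ^ 2) := by
          field_simp
      _ ≤ _ := by gcongr

end LeadingTerm

/-! ### Singular value asymptotics of the resolvent -/

section MainResult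

variable {n : ℕ} {b : Fin n → ℂ} {C D : Matrix (Fin n) (Fin n) ℂ}
  {Q : ℝ → Matrix (Fin n) (Fin n) ℂ} {z : ℂ} {R : L2 n →L[ℂ] L2 n}

theorem exists_resolvent_le (hb : ∀ j, b j ≠ 0) {δ : ℝ} {ι : Type}
    (Λ : L2 n →ₗ[ℂ] (ι → ℂ)) (hΛ : ∀ f, Λ f = 0 → ‖R f - leadingTerm b f‖ ≤ δ * ‖f‖)
    {X : ℝ} (hX : 0 < X) :
    ∃ Λ' : L2 n →ₗ[ℂ] ((Σ j : Fin n,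
        Option (Finset.Icc (-(⌊‖b j‖ * X⌋₊ : ℤ)) ⌊‖b j‖ * X⌋₊)) ⊕ ι → ℂ),
      ∀ f, Λ' f = 0 → ‖R f‖ ≤ (1 / (2 * Real.pi * X) + δ) * ‖f‖ := by
  obtain ⟨Λ₁, hΛ₁⟩ := exists_leadingTerm_le hb hX
  refine ⟨LinearMap.pi fun q => Sum.elim (fun i => LinearMap.proj i ∘ₗ Λ₁)
    (fun i => LinearMap.proj i ∘ₗ Λ) q, fun f hf => ?_⟩
  have h1 := hΛ₁ f (funext fun i => congrFun hf (Sum.inl i))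
  have h2 := hΛ f (funext fun i => congrFun hf (Sum.inr i))
  calc ‖R f‖ = ‖leadingTerm b f + (R f - leadingTerm b f)‖ := by rw [add_sub_cancel]
    _ ≤ ‖leadingTerm b f‖ + ‖R f - leadingTerm b f‖ := norm_add_le _ _
    _ ≤ (1 / (2 * Real.pi * X) + δ) * ‖f‖ := by linarith

/-- The remainder is `o(1/k)`, as `tendsto_mul_of_bounds` requires. -/
theorem tendsto_mul_div_mul_sqrt (c : ℝ) :
    Tendsto (fun k : ℕ => (k : ℝ) * (c / (k * Real.sqrt k))) atTop (𝓝 0) := by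
  have h : Tendsto (fun k : ℕ => c / Real.sqrt k) atTop (𝓝 0) :=
    tendsto_const_nhds.div_atTop (Real.tendsto_sqrt_atTop.comp tendsto_natCast_atTop_atTop)
  refine h.congr' ?_
  filter_upwards [eventually_gt_atTop 0] with k hk
  have hk' : (0 : ℝ) < k := by exact_mod_cast hk
  have : Real.sqrt k ≠ 0 := by positivity
  field_simp

theorem isSmallOnKernels_of_isResolventAt (hb : ∀ j, b j ≠ 0)
    (hQ : ∀ j k, IntegrableOn (fun x => Q x j k) (Set.Icc (0 : ℝ) 1))
    (hR : IsResolventAt (op b C D Q) z R) : IsSmallOnKernels R := by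
  obtain ⟨c, k₀, hc, hrem⟩ := exists_remainder_bound hb hQ hR
  intro ε hε
  have h1 : Tendsto (fun k : ℕ => c / (k * Real.sqrt k)) atTop (𝓝 0) := by
    refine tendsto_const_nhds.div_atTop ?_
    exact tendsto_natCast_atTop_atTop.atTop_mul_atTop₀
      (Real.tendsto_sqrt_atTop.comp tendsto_natCast_atTop_atTop)
  obtain ⟨k, hk, hkε⟩ := ((eventually_ge_atTop k₀).and
    (h1.eventually (gt_mem_nhds (half_pos hε)))).exists
  obtain ⟨Λ, hΛ⟩ := hrem k hk
  have hpi := Real.pi_pos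
  -- This `X` makes the leading bound exactly `ε / 2`.
  obtain ⟨Λ', hΛ'⟩ := exists_resolvent_le hb Λ hΛ (X := 1 / (Real.pi * ε)) (by positivity)
  refine ⟨_, inferInstance, Λ', fun f hf => ?_⟩
  refine (hΛ' f hf).trans ?_
  gcongr
  have : 1 / (2 * Real.pi * (1 / (Real.pi * ε))) = ε / 2 := by field_simp
  linarith

/-- The asymptotics of the singular values of the resolvent. -/
theorem tendsto_singularValue (hn : 1 ≤ n) (hb : ∀ j, b j ≠ 0)
    (hQ : ∀ j k, IntegrableOn (fun x => Q x j k) (Set.Icc (0 : ℝ) 1))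
    (hR : IsResolventAt (op b C D Q) z R) :
    Tendsto (fun N : ℕ => ((N : ℝ) + 1) * singularValue R N) atTop
      (𝓝 ((∑ j, ‖b j‖) / Real.pi)) := by
  have hpi := Real.pi_pos
  have hsmall := isSmallOnKernels_of_isResolventAt hb hQ hR
  obtain ⟨c, k₀, hc, hrem⟩ := exists_remainder_bound hb hQ hR
  have hn' : (1 : ℝ) ≤ n := by exact_mod_cast hn
  have hS : 0 < ∑ j, ‖b j‖ := by
    have : NeZero n := ⟨by omega⟩
    exact Finset.sum_pos (fun j _ => norm_pos_iff.2 (hb j)) Finset.univ_nonempty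
  have hcard : ∀ k : ℕ, Fintype.card ((Option (Fin (k + 1)) ⊕ Fin (k + 1)) × Fin n) =
      (2 * k + 3) * n := fun k => by
    simp only [Fintype.card_prod, Fintype.card_sum, Fintype.card_option, Fintype.card_fin]
    ring
  -- The `(2k + 3) n` remainder conditions and `2n` from rounding and the means total `(2k + 5) n ≤
  -- 5n (k + 1)`.
  refine tendsto_mul_of_bounds (c := 5 * n) hS (by positivity) k₀ (tendsto_mul_div_mul_sqrt c)
    (fun X k N hX hk hN => ?_) (fun X k N hX hk hN => ?_)
  · obtain ⟨Λ, hΛ⟩ := hrem k hk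
    obtain ⟨Λ', hΛ'⟩ := exists_resolvent_le hb Λ hΛ hX
    refine singularValue_le R (by positivity) Λ' hΛ' ?_
    rw [Fintype.card_sum, hcard, Fintype.card_sigma]
    have h1 : ∀ j, Fintype.card (Option (Finset.Icc (-(⌊‖b j‖ * X⌋₊ : ℤ)) ⌊‖b j‖ * X⌋₊)) =
        2 * ⌊‖b j‖ * X⌋₊ + 2 := fun j => by
      rw [Fintype.card_option, Fintype.card_coe, Int.card_Icc]
      omega
    simp only [h1]
    have h2 : ∑ j, ((2 : ℝ) * ⌊‖b j‖ * X⌋₊ + 2) ≤ 2 * (∑ j, ‖b j‖) * X + 2 * n := by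
      have : ∑ j, ((2 : ℝ) * ⌊‖b j‖ * X⌋₊ + 2) ≤ ∑ j, (2 * (‖b j‖ * X) + 2) := by
        gcongr with j
        exact Nat.floor_le (by positivity)
      refine this.trans (le_of_eq ?_)
      rw [Finset.sum_add_distrib, ← Finset.mul_sum, ← Finset.sum_mul]
      simp
      ring
    have h3 : ((∑ j, (2 * ⌊‖b j‖ * X⌋₊ + 2) + (2 * k + 3) * n : ℕ) : ℝ) ≤ N := by
      push_cast
      have : (0 : ℝ) ≤ k * n := by positivity
      linarith
    exact_mod_cast h3
  · obtain ⟨Λ, hΛ⟩ := hrem k hk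
    obtain ⟨V, hVfin, hVdim, hV⟩ := exists_le_leadingTerm hb hX
    rcases le_or_gt (1 / (2 * Real.pi * X) - c / (k * Real.sqrt k)) 0 with hneg | hpos
    · exact hneg.trans (singularValue_nonneg R N)
    -- Imposing the remainder conditions on the Fourier space costs at most `(2k + 3) n` dimensions;
    -- on `W` both estimates hold.
    let W : Submodule ℂ V := LinearMap.ker (Λ.domRestrict V)
    have hWdim : Module.finrank ℂ V ≤ (2 * k + 3) * n + Module.finrank ℂ W := by
      rw [← LinearMap.finrank_range_add_finrank_ker (Λ.domRestrict V)]
      gcongr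
      refine (Submodule.finrank_le _).trans ?_
      rw [Module.finrank_fintype_fun_eq_card, hcard]
    have hdim : N < Module.finrank ℂ W := by
      have h2 : 2 * (∑ j, ‖b j‖) * X - 2 * n < ∑ j, (2 : ℝ) * ⌊‖b j‖ * X⌋₊ := by
        have : NeZero n := ⟨by omega⟩
        have : ∑ j, (2 * (‖b j‖ * X) - 2) < ∑ j, (2 : ℝ) * ⌊‖b j‖ * X⌋₊ := by
          refine Finset.sum_lt_sum_of_nonempty Finset.univ_nonempty fun j _ => ?_
          have := Nat.lt_floor_add_one (‖b j‖ * X)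
          linarith
        refine lt_of_eq_of_lt ?_ this
        rw [Finset.sum_sub_distrib, ← Finset.mul_sum, ← Finset.sum_mul]
        simp
        ring
      rw [hVdim] at hWdim
      have h3 : (∑ j, (2 : ℝ) * ⌊‖b j‖ * X⌋₊) ≤ (2 * k + 3) * n + Module.finrank ℂ W := by
        exact_mod_cast hWdim
      have h4 : (N : ℝ) < Module.finrank ℂ W := by
        have : (0 : ℝ) ≤ k * n := by positivity
        linarith
      exact_mod_cast h4
    refine le_singularValue hsmall hpos (W.map V.subtype) (k := N) ?_ ?_
    · rwa [Submodule.finrank_map_subtype_eq]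
    · rintro _ ⟨⟨f, hfV⟩, hfW, rfl⟩
      have h1 := hV f hfV
      have h2 := hΛ f hfW
      have h3 : ‖leadingTerm b f‖ ≤ ‖R f‖ + ‖R f - leadingTerm b f‖ := by
        rw [norm_sub_rev]
        exact norm_le_norm_add_norm_sub' _ _
      simp only [Submodule.subtype_apply]
      linarith

end MainResult

end DiracBVP

theorem mainTheorem6 (n : ℕ) (hn : 1 ≤ n) (b : Fin n → ℂ) (hb : ∀ j, b j ≠ 0)
    (C D : Matrix (Fin n) (Fin n) ℂ) (hCD : (Matrix.fromCols C D).rank = n)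
    (Q : ℝ → Matrix (Fin n) (Fin n) ℂ)
    (hQ : ∀ j k, IntegrableOn (fun x => Q x j k) (Set.Icc (0 : ℝ) 1))
    (z : ℂ) (hz : z ∈ DiracBVP.resolventSet (DiracBVP.op b C D Q)) :
    -- membership in the weak ideal of exponent `1`, but not in the trace class
    (DiracBVP.IsWeakSchatten 1 (DiracBVP.resolvent (DiracBVP.op b C D Q) z) ∧
      ¬ DiracBVP.IsSchatten 1 (DiracBVP.resolvent (DiracBVP.op b C D Q) z)) ∧
    -- `ν j` lists, in increasing order, the positions of the `j`-th subsequence; the `n`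
    -- subsequences are disjoint and exhaust the sequence of singular values (indexed from `0`)
    ∃ ν : Fin n → ℕ → ℕ, (∀ j, StrictMono (ν j)) ∧
      Function.Bijective (fun p : Fin n × ℕ => ν p.1 p.2) ∧
      ∀ j, Antitone (fun k : ℕ =>
          DiracBVP.singularValue (DiracBVP.resolvent (DiracBVP.op b C D Q) z) (ν j k)) ∧
        ∃ ε : ℕ → ℝ, Tendsto ε atTop (𝓝 0) ∧
          ∀ k : ℕ, DiracBVP.singularValue (DiracBVP.resolvent (DiracBVP.op b C D Q) z) (ν j k)
            = (‖b j‖ + ε k) / (Real.pi * ((k : ℝ) + 1)) := by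
  have hR := DiracBVP.isResolventAt_resolvent hz
  set R := DiracBVP.resolvent (DiracBVP.op b C D Q) z
  have hpi := Real.pi_pos
  have : NeZero n := ⟨by omega⟩
  have hcomp : IsCompactOperator R :=
    (DiracBVP.isSmallOnKernels_of_isResolventAt hb hQ hR).isCompactOperator
  have hlim := DiracBVP.tendsto_singularValue hn hb hQ hR
  set S := ∑ j, ‖b j‖ with hSdef
  have hS : 0 < S := Finset.sum_pos (fun j _ => norm_pos_iff.2 (hb j)) Finset.univ_nonempty
  refine ⟨⟨⟨hcomp, ?_⟩, ?_⟩, ?_⟩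
  · refine Asymptotics.IsBigO.of_bound (S / Real.pi + 1) ?_
    filter_upwards [hlim.eventually (gt_mem_nhds (lt_add_one _))] with N hN
    have hN1 : (0 : ℝ) < N + 1 := by positivity
    rw [div_one, Real.rpow_neg_one, norm_inv, Real.norm_of_nonneg hN1.le,
      Real.norm_of_nonneg (DiracBVP.singularValue_nonneg R N), ← div_eq_mul_inv,
      le_div_iff₀ hN1, mul_comm]
    exact hN.le
  · rintro ⟨-, hsum⟩
    simp only [Real.rpow_one] at hsum
    have hL : 0 < S / Real.pi := by positivity
    -- Eventually `s_N ≥ (S / 2π) / (N + 1)`, so summability would force the harmonic series to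
    -- converge.
    have h1 : Summable fun N : ℕ => 1 / ((N : ℝ) + 1) := by
      refine Summable.of_norm_bounded_eventually_nat
        (g := fun N => (S / Real.pi / 2)⁻¹ * DiracBVP.singularValue R N) (hsum.mul_left _) ?_
      filter_upwards [hlim.eventually (lt_mem_nhds (half_lt_self hL))] with N hN
      have hN1 : (0 : ℝ) < N + 1 := by positivity
      rw [Real.norm_of_nonneg (by positivity), div_le_iff₀ hN1, mul_assoc,
        ← div_eq_inv_mul, one_le_div (by positivity), mul_comm]
      exact hN.le
    have h2 := (summable_nat_add_iff (f := fun N : ℕ => 1 / (N : ℝ)) 1).1 (by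
      simpa only [Nat.cast_add, Nat.cast_one] using h1)
    exact Real.not_summable_one_div_natCast h2
  · obtain ⟨ν, hmono, hbij, hdens⟩ := DiracBVP.exists_partition_of_densities
      (p := fun j => ‖b j‖ / S) (fun j => div_pos (norm_pos_iff.2 (hb j)) hS)
      (by rw [← Finset.sum_div, ← hSdef, div_self hS.ne'])
    refine ⟨ν, hmono, hbij, fun j =>
      ⟨(DiracBVP.singularValue_antitone R).comp_monotone (hmono j).monotone,
      fun k => DiracBVP.singularValue R (ν j k) * (Real.pi * ((k : ℝ) + 1)) - ‖b j‖, ?_, ?_⟩⟩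
    · have h := (((hlim.comp (hmono j).tendsto_atTop).mul (hdens j)).mul_const Real.pi).sub_const
        ‖b j‖
      have hval : S / Real.pi * (‖b j‖ / S) * Real.pi - ‖b j‖ = 0 := by
        field_simp
        ring
      rw [hval] at h
      refine h.congr fun k => ?_
      have hν : ((ν j k : ℝ) + 1) ≠ 0 := by positivity
      simp only [Function.comp_apply]
      field_simp
    · intro k
      have hk : (0 : ℝ) < (k : ℝ) + 1 := by positivity
      rw [add_sub_cancel, mul_div_cancel_right₀]
      positivity
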